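/- Let $n\ge 1$ and let $\Sigma^n\subset\mathbf{R}^{n+1}$ be a smooth embedded hypersurface (without boundary, not necessarily closed or complete) with a smooth unit normal field $\mathbf{n}$. Let $H=\operatorname{div}_\Sigma\mathbf{n}$ be its mean curvature, $A$ its second fundamental form, $\nabla$ and $\Delta$ the gradient and the Laplace operator of $\Sigma$, $\rho(x)=e^{-|x|^2/4}$, and let integrals over $\Sigma$ be taken with respect to the $n$-dimensional area. Suppose that $\Sigma$ is a self-shrinker, i.e. $H=\frac12\langle x,\mathbf{n}\rangle$ at every $x\in\Sigma$. Let $R\in\mathbf{R}$, let $B_R$ be the closed ball of radius $R$ about the origin, and suppose that $\Sigma$ is graphical in $B_R$, i.e. there is a constant vector $v\in\mathbf{R}^{n+1}$ with $\langle v,\mathbf{n}\rangle>0$ at each point of $\Sigma\cap B_R$. Then $\Sigma$ is $\frac12$-stable in $B_R$: with $L=\Delta-\frac12\langle x,\nabla\,\cdot\,\rangle+|A|^2+\frac12$, $$\int_\Sigma(-\phi L\phi)\,\rho+\frac12\int_\Sigma\phi^2\rho\ \ge\ 0$$ for every $C^2$ function $\phi$ on $\Sigma$ whose support is a compact subset of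 $\Sigma\cap B_R$. Moreover, for every $C^1$ function $\phi$ on $\Sigma$ whose support is a compact subset of $\Sigma\cap B_R$, both integrals below are finite and $$\int_\Sigma|A|^2\phi^2\rho\ \le\ \int_\Sigma|\nabla\phi|^2\rho .$$ -/

import Mathlib

open MeasureTheory
open scoped ContDiff

noncomputable section

namespace Shrinker

/-- The ambient Euclidean space `ℝⁿ⁺¹`. -/
abbrev Amb (n : ℕ) : Type := EuclideanSpace ℝ (Fin (n + 1))

/-- `S ⊆ ℝⁿ⁺¹` is a smooth embedded hypersurface (without boundary, not necessarily closed or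
connected): around each of its points there is a smooth chart of `ℝⁿ⁺¹`, with values in `ℝⁿ × ℝ`,
in which `S` is the slice `t = 0`. -/
def IsSmoothHypersurface {n : ℕ} (S : Set (Amb n)) : Prop :=
  ∀ p ∈ S, ∃ Φ : OpenPartialHomeomorph (Amb n) (EuclideanSpace ℝ (Fin n) × ℝ),
    p ∈ Φ.source ∧ ContDiffOn ℝ ∞ Φ Φ.source ∧ ContDiffOn ℝ ∞ Φ.symm Φ.target ∧
      ∀ x ∈ Φ.source, (x ∈ S ↔ (Φ x).2 = 0)

/-- The tangent space `T_p S`: the span of the limits of directions of secants of `S` at `p`. -/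
def tangentSpaceAt {n : ℕ} (S : Set (Amb n)) (p : Amb n) : Submodule ℝ (Amb n) :=
  Submodule.span ℝ (tangentConeAt ℝ S p)

/-- The orthogonal projection of `ℝⁿ⁺¹` onto `T_p S`. -/
def tangentProj {n : ℕ} (S : Set (Amb n)) (p : Amb n) : Amb n →L[ℝ] Amb n :=
  (tangentSpaceAt S p).starProjection

/-- The derivative at `p` of a map `f` on `S`, along `T_p S`, extended by zero to the normal
direction. A derivative of `f` within `S` is determined on `T_p S` only; the projection removes
the undetermined part, and the values of `f` off `S` play no role for `p ∈ S`. -/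
def tangentDeriv {n : ℕ} {F : Type*} [NormedAddCommGroup F] [NormedSpace ℝ F]
    (S : Set (Amb n)) (f : Amb n → F) (p : Amb n) : Amb n →L[ℝ] F :=
  (fderivWithin ℝ f S p).comp (tangentProj S p)

/-- The gradient `∇φ` on `S`: the vector of `T_p S` that represents the derivative of `φ`. -/
def grad {n : ℕ} (S : Set (Amb n)) (φ : Amb n → ℝ) (p : Amb n) : Amb n :=
  (InnerProductSpace.toDual ℝ (Amb n)).symm (tangentDeriv S φ p)

/-- The divergence `div_S V = ∑ ⟨D_{e_i} V, e_i⟩`, for an orthonormal basis `e_i` of `T_p S`,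
of a (not necessarily tangential) vector field `V` along `S`, written as a trace. -/
def surfDiv {n : ℕ} (S : Set (Amb n)) (V : Amb n → Amb n) (p : Amb n) : ℝ :=
  LinearMap.trace ℝ (Amb n) ((tangentProj S p).comp (tangentDeriv S V p) : Amb n →L[ℝ] Amb n)

/-- The Laplace operator of `S`. -/
def laplacian {n : ℕ} (S : Set (Amb n)) (φ : Amb n → ℝ) (p : Amb n) : ℝ :=
  surfDiv S (grad S φ) p

/-- `ν` is a smooth unit normal field on `S`. -/
structure IsUnitNormal {n : ℕ} (S : Set (Amb n)) (ν : Amb n → Amb n) : Prop where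
  smooth : ContDiffOn ℝ ∞ ν S
  norm_eq_one : ∀ p ∈ S, ‖ν p‖ = 1
  normal : ∀ p ∈ S, ∀ w ∈ tangentSpaceAt S p, inner ℝ (ν p) w = 0

/-- The mean curvature `H = div_S ν`. -/
def meanCurv {n : ℕ} (S : Set (Amb n)) (ν : Amb n → Amb n) (p : Amb n) : ℝ :=
  surfDiv S ν p

/-- The second fundamental form `A(u, w) = ⟨D_u ν, w⟩` for `u`, `w` in `T_p S`, extended by zero
to the normal direction. -/
def secondFF {n : ℕ} (S : Set (Amb n)) (ν : Amb n → Amb n) (p u w : Amb n) : ℝ :=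
  inner ℝ (tangentDeriv S ν p u) (tangentProj S p w)

/-- `|A|²`, the sum of the squares of the entries of `A` in an orthonormal basis. As `A` is
extended by zero, an orthonormal basis of `ℝⁿ⁺¹` gives the same sum as one of `T_p S`. -/
def normSqA {n : ℕ} (S : Set (Amb n)) (ν : Amb n → Amb n) (p : Amb n) : ℝ :=
  ∑ i : Fin (n + 1), ∑ j : Fin (n + 1),
    secondFF S ν p (EuclideanSpace.single i 1) (EuclideanSpace.single j 1) ^ 2

/-- `S` with the unit normal field `ν` is a self-shrinker: a smooth hypersurface with
`H = ⟨x, ν⟩ / 2`. -/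
structure IsSelfShrinker {n : ℕ} (S : Set (Amb n)) (ν : Amb n → Amb n) : Prop where
  hypersurface : IsSmoothHypersurface S
  unitNormal : IsUnitNormal S ν
  shrinker : ∀ p ∈ S, meanCurv S ν p = (1 / 2) * inner ℝ p (ν p)

/-- `S` is graphical in `Ω`: a constant vector `v` has `⟨v, ν⟩ > 0` on `S ∩ Ω`. -/
def IsGraphicalIn {n : ℕ} (S : Set (Amb n)) (ν : Amb n → Amb n) (Ω : Set (Amb n)) : Prop :=
  ∃ v : Amb n, ∀ p ∈ S ∩ Ω, 0 < (inner ℝ v (ν p) : ℝ)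

/-- The Gaussian weight `ρ = e^{-|x|²/4}`. -/
def rho {n : ℕ} (x : Amb n) : ℝ := Real.exp (-‖x‖ ^ 2 / 4)

/-- The area measure of `S`: the `n`-dimensional Hausdorff measure, normalized so that it is
Lebesgue measure on `n`-dimensional planes, restricted to `S`. -/
def area {n : ℕ} (S : Set (Amb n)) : Measure (Amb n) :=
  (Measure.euclideanHausdorffMeasure n).restrict S

/-- The stability operator `L = Δ - ⟨x, ∇ ·⟩ / 2 + |A|² + 1 / 2`. -/
def stabOp {n : ℕ} (S : Set (Amb n)) (ν : Amb n → Amb n) (φ : Amb n → ℝ) (p : Amb n) : ℝ :=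
  laplacian S φ p - (1 / 2) * inner ℝ p (grad S φ p) + normSqA S ν p * φ p + (1 / 2) * φ p

/-- The function `φ` on `S` has compact support contained in `S ∩ Ω`. -/
def SupportedIn {n : ℕ} (S Ω : Set (Amb n)) (φ : Amb n → ℝ) : Prop :=
  ∃ K : Set (Amb n), IsCompact K ∧ K ⊆ S ∩ Ω ∧ ∀ p ∈ S, p ∉ K → φ p = 0

/-- `S` is `δ`-stable in `Ω`: `∫ (-φ Lφ) ρ + δ ∫ φ² ρ ≥ 0` for all twice continuously
differentiable functions `φ` on `S` with compact support in `Ω`. -/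
def IsStableIn {n : ℕ} (S : Set (Amb n)) (ν : Amb n → Amb n) (δ : ℝ) (Ω : Set (Amb n)) : Prop :=
  ∀ φ : Amb n → ℝ, ContDiffOn ℝ 2 φ S → SupportedIn S Ω φ →
    0 ≤ (∫ x, -(φ x * stabOp S ν φ x) * rho x ∂(area S)) + δ * ∫ x, φ x ^ 2 * rho x ∂(area S)

end Shrinker

end

/-!
Write `u = ⟨v, ν⟩`. On a self-shrinker the Codazzi equation and `∇H = A x / 2` give the Jacobi
equation `Δu - ⟨x, ∇u⟩ / 2 = -|A|² u` (`laplacian_inner_normal`). Where `u > 0`, the tangential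
field `φ² ρ ∇u / u` therefore has divergence
`ρ (|∇φ|² - |A|² φ² - |∇φ - φ ∇u / u|²)`, and the divergence theorem gives the stability inequality
(`integral_normSqA_le`). Only the values of `u` on the support of `φ` matter. The divergence theorem
for `φ ρ ∇φ` turns the quadratic form of `L` into the difference of the two sides of this inequality
(`integral_stabOp_eq`).

Derivatives along `S` are computed in graph charts (`GraphChart`): near each point, `S` is the graph
`G` of a function over its tangent space, and a function on `S` extends to a neighbourhood so that it
is constant along the normal direction `e` of that tangent space. In such a chart the symmetry of the
second fundamental form is the symmetry of `D²G`, and the Codazzi equation is the symmetry of the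
second derivative of the extended normal field.

The area measure is a Hausdorff measure, so the divergence theorem (`integral_surfDiv_eq_zero`) rests
on the area formula `euclideanHausdorffMeasure_image_eq_lintegral`: an immersion is locally
bi-Lipschitz to its derivative with constants near `1`, and linear maps scale Hausdorff measure by
`LinearMap.normDet`. For a graph the Jacobian is `1 / ⟨ν, e⟩`, and if `π` is the projection to the
parameter space, `⟨ν, e⟩⁻¹ div_S X` is the Euclidean divergence of `⟨ν, e⟩⁻¹ π X`. A partition of
unity removes the restriction to one chart.
-/

open MeasureTheory
open scoped ContDiff Topology

namespace Shrinker

/-! ### Tangent spaces and graph charts -/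

variable {n : ℕ} {S : Set (Amb n)} {ν : Amb n → Amb n} {p : Amb n}

/-- Any derivative of `f` within `S` may be used to compute the tangential derivative. -/
lemma tangentDeriv_eq {F : Type*} [NormedAddCommGroup F] [NormedSpace ℝ F] {f : Amb n → F}
    {f' : Amb n →L[ℝ] F} (h : HasFDerivWithinAt f f' S p) :
    tangentDeriv S f p = f'.comp (tangentProj S p) := by
  have key : ∀ w ∈ tangentSpaceAt S p, fderivWithin ℝ f S p w = f' w := by
    intro w hw
    have : Set.EqOn (fderivWithin ℝ f S p) f' (tangentConeAt ℝ S p) :=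
      h.differentiableWithinAt.hasFDerivWithinAt.unique_on h
    exact LinearMap.eqOn_span (f := (fderivWithin ℝ f S p : Amb n →ₗ[ℝ] F))
      (g := (f' : Amb n →ₗ[ℝ] F)) this hw
  ext w
  exact key _ (Submodule.starProjection_apply_mem _ w)

lemma tangentDeriv_congr {F : Type*} [NormedAddCommGroup F] [NormedSpace ℝ F] {f g : Amb n → F}
    (h : Set.EqOn f g S) (hp : p ∈ S) : tangentDeriv S f p = tangentDeriv S g p := by
  unfold tangentDeriv
  rw [fderivWithin_congr h (h hp)]

/-- What is used of a slice chart at `p`: its last component `τ`, which vanishes exactly on `S`, and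
the mutually inverse derivatives `Φ'` and `Ψ'` of the chart and of its inverse at `p`. -/
lemma IsSmoothHypersurface.exists_slice (hS : IsSmoothHypersurface S) (hp : p ∈ S) :
    ∃ (τ : Amb n → ℝ) (U : Set (Amb n)) (Φ' : Amb n →L[ℝ] EuclideanSpace ℝ (Fin n) × ℝ)
      (Ψ' : EuclideanSpace ℝ (Fin n) × ℝ →L[ℝ] Amb n),
      IsOpen U ∧ p ∈ U ∧ ContDiffOn ℝ ∞ τ U ∧ (∀ x ∈ U, (x ∈ S ↔ τ x = 0)) ∧
      HasFDerivAt τ ((ContinuousLinearMap.snd ℝ _ _).comp Φ') p ∧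
      (∀ z, Ψ' (Φ' z) = z) ∧ (∀ y, Φ' (Ψ' y) = y) ∧
      ∀ w, Ψ' (w, 0) ∈ tangentSpaceAt S p := by
  obtain ⟨Φ, hpΦ, hΦ, hΨ, hsl⟩ := hS p hp
  have hΦd : HasFDerivAt Φ (fderiv ℝ Φ p) p :=
    ((hΦ.contDiffAt (Φ.open_source.mem_nhds hpΦ)).differentiableAt (by simp)).hasFDerivAt
  have hΨd : HasFDerivAt Φ.symm (fderiv ℝ Φ.symm (Φ p)) (Φ p) :=
    ((hΨ.contDiffAt (Φ.open_target.mem_nhds (Φ.map_source hpΦ))).differentiableAt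
      (by simp)).hasFDerivAt
  have h1 : ∀ z, fderiv ℝ Φ.symm (Φ p) (fderiv ℝ Φ p z) = z := by
    intro z
    have h2 := hΨd.comp p hΦd
    have h3 : HasFDerivAt (Φ.symm ∘ Φ) (ContinuousLinearMap.id ℝ (Amb n)) p :=
      (hasFDerivAt_id p).congr_of_eventuallyEq
        (Filter.eventuallyEq_of_mem (Φ.open_source.mem_nhds hpΦ) fun x hx => Φ.left_inv hx)
    exact congrArg (fun L : Amb n →L[ℝ] Amb n => L z) (h2.unique h3)
  have h1' : ∀ z, fderiv ℝ Φ p (fderiv ℝ Φ.symm (Φ p) z) = z := by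
    intro z
    have hΦd' : HasFDerivAt Φ (fderiv ℝ Φ p) (Φ.symm (Φ p)) := by rwa [Φ.left_inv hpΦ]
    have h2 := hΦd'.comp (Φ p) hΨd
    have h3 : HasFDerivAt (Φ ∘ Φ.symm) (ContinuousLinearMap.id ℝ _) (Φ p) :=
      (hasFDerivAt_id _).congr_of_eventuallyEq
        (Filter.eventuallyEq_of_mem (Φ.open_target.mem_nhds (Φ.map_source hpΦ))
          fun x hx => Φ.right_inv hx)
    exact congrArg (fun L : (EuclideanSpace ℝ (Fin n) × ℝ) →L[ℝ] _ => L z) (h2.unique h3)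
  refine ⟨fun x => (Φ x).2, Φ.source, fderiv ℝ Φ p, fderiv ℝ Φ.symm (Φ p), Φ.open_source, hpΦ,
    contDiff_snd.comp_contDiffOn hΦ, hsl, hasFDerivAt_snd.comp p hΦd, h1, h1', fun w => ?_⟩
  have h0 : (Φ p).2 = 0 := (hsl p hpΦ).1 hp
  have hΦp : Φ p = ((Φ p).1, (0 : ℝ)) := Prod.ext rfl h0
  let W : Set (EuclideanSpace ℝ (Fin n)) := (fun y => (y, (0 : ℝ))) ⁻¹' Φ.target
  have hW : W ∈ nhds (Φ p).1 := by
    refine (Φ.open_target.preimage (by fun_prop)).mem_nhds ?_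
    change ((Φ p).1, (0 : ℝ)) ∈ Φ.target
    rw [← hΦp]; exact Φ.map_source hpΦ
  have hg : HasFDerivAt (fun y => Φ.symm (y, (0 : ℝ)))
      ((fderiv ℝ Φ.symm (Φ p)).comp (ContinuousLinearMap.inl ℝ _ _)) (Φ p).1 := by
    have h4 : HasFDerivAt Φ.symm (fderiv ℝ Φ.symm (Φ p)) ((Φ p).1, (0 : ℝ)) := by
      rw [← hΦp]; exact hΨd
    exact h4.comp (Φ p).1 (hasFDerivAt_prodMk_left _ _)
  have h5 := hg.hasFDerivWithinAt (s := W) |>.mapsTo_tangent_cone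
  rw [tangentConeAt_of_mem_nhds hW] at h5
  have h6 := h5 (Set.mem_univ w)
  have h7 : (fun y => Φ.symm (y, (0 : ℝ))) '' W ⊆ S := by
    rintro _ ⟨y, hy, rfl⟩
    rw [hsl _ (Φ.map_target hy), Φ.right_inv hy]
  have h8 : Φ.symm ((Φ p).1, (0 : ℝ)) = p := by rw [← hΦp]; exact Φ.left_inv hpΦ
  rw [h8] at h6
  exact Submodule.subset_span (tangentConeAt_mono h7 h6)

/-- The tangent space is all of `ν⊥`, because the inverse of a slice chart maps `ℝⁿ × 0` injectively
into it. -/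
lemma IsUnitNormal.tangentSpaceAt_eq (hν : IsUnitNormal S ν) (hS : IsSmoothHypersurface S)
    (hp : p ∈ S) : tangentSpaceAt S p = (Submodule.span ℝ {ν p})ᗮ := by
  obtain ⟨_, _, Φ', Ψ', -, -, -, -, -, -, h1, hT⟩ := hS.exists_slice hp
  have hne : ν p ≠ 0 := fun h => by simpa [h] using hν.norm_eq_one p hp
  refine Submodule.eq_of_le_of_finrank_le (fun w hw => ?_) ?_
  · rw [Submodule.mem_orthogonal_singleton_iff_inner_right]
    exact hν.normal p hp w hw
  · have : Fact (Module.finrank ℝ (Amb n) = n + 1) := ⟨by simp⟩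
    rw [Submodule.finrank_orthogonal_span_singleton (n := n) hne]
    let g : EuclideanSpace ℝ (Fin n) →ₗ[ℝ] tangentSpaceAt S p :=
      ((Ψ' : _ →ₗ[ℝ] Amb n).comp (LinearMap.inl ℝ _ ℝ)).codRestrict _ hT
    have hg : Function.Injective g := by
      intro a b hab
      have h2 : Ψ' (a, 0) = Ψ' (b, 0) := congrArg Subtype.val hab
      have h3 := congrArg Φ' h2
      rw [h1, h1] at h3
      exact congrArg Prod.fst h3
    simpa using LinearMap.finrank_le_finrank_of_injective hg

lemma IsUnitNormal.tangentProj_apply (hν : IsUnitNormal S ν) (hS : IsSmoothHypersurface S)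
    (hp : p ∈ S) (w : Amb n) : tangentProj S p w = w - inner ℝ (ν p) w • ν p := by
  unfold tangentProj
  simp only [hν.tangentSpaceAt_eq hS hp]
  rw [Submodule.starProjection_orthogonal_val,
    Submodule.starProjection_unit_singleton ℝ (hν.norm_eq_one p hp)]

/-- A piece of `S` written as a graph over an `n`-dimensional linear subspace of `ℝⁿ⁺¹`: the
subspace is the range of the linear isometry `ι`, with unit normal `e`, the orthogonal projection to
it is `π`, read in the parameter space `ℝⁿ`, and `G` is the inverse of the projection from `S ∩ V` to
the open set `W`. The unit normal of `S` points to the side of `e`. Regularity `C²` is enough below;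
the inverse function theorem gives a neighbourhood on which `G` is `Cᵏ` only for finite `k`. -/
structure GraphChart {n : ℕ} (S : Set (Amb n)) (ν : Amb n → Amb n) where
  ι : EuclideanSpace ℝ (Fin n) →ₗᵢ[ℝ] Amb n
  π : Amb n →L[ℝ] EuclideanSpace ℝ (Fin n)
  e : Amb n
  W : Set (EuclideanSpace ℝ (Fin n))
  V : Set (Amb n)
  G : EuclideanSpace ℝ (Fin n) → Amb n
  norm_e : ‖e‖ = 1
  inner_e : ∀ w, inner ℝ (ι w) e = 0
  ι_π : ∀ z, ι (π z) = z - inner ℝ e z • e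
  isOpen_W : IsOpen W
  isOpen_V : IsOpen V
  contDiffOn_G : ContDiffOn ℝ 2 G W
  G_mem : ∀ x ∈ W, G x ∈ S
  G_mem_V : ∀ x ∈ W, G x ∈ V
  π_G : ∀ x ∈ W, π (G x) = x
  π_mem : ∀ z ∈ S ∩ V, π z ∈ W
  G_π : ∀ z ∈ S ∩ V, G (π z) = z
  inner_pos : ∀ x ∈ W, 0 < inner ℝ (ν (G x)) e

/-- An orthogonal decomposition `ℝⁿ⁺¹ = ℝⁿ ⊕ ℝ e` for a given unit vector `e`. -/
lemma exists_isometry_orthogonal {e : Amb n} (he : ‖e‖ = 1) :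
    ∃ (ι : EuclideanSpace ℝ (Fin n) →ₗᵢ[ℝ] Amb n) (π : Amb n →L[ℝ] EuclideanSpace ℝ (Fin n)),
      (∀ w, inner ℝ (ι w) e = 0) ∧ ∀ z, ι (π z) = z - inner ℝ e z • e := by
  have : Fact (Module.finrank ℝ (Amb n) = n + 1) := ⟨by simp⟩
  have hne : e ≠ 0 := fun h => by simp [h] at he
  let b := OrthonormalBasis.fromOrthogonalSpanSingleton (𝕜 := ℝ) n hne
  let ι : EuclideanSpace ℝ (Fin n) →ₗᵢ[ℝ] Amb n :=
    (Submodule.subtypeₗᵢ _).comp b.repr.symm.toLinearIsometry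
  have h1 : ∀ w, inner ℝ (ι w) e = 0 := by
    intro w
    have := (b.repr.symm w).2
    rw [Submodule.mem_orthogonal_singleton_iff_inner_left] at this
    exact this
  refine ⟨ι, ι.toContinuousLinearMap.adjoint, h1, fun z => ?_⟩
  have hmem : z - inner ℝ e z • e ∈ (Submodule.span ℝ {e})ᗮ := by
    rw [Submodule.mem_orthogonal_singleton_iff_inner_right]
    simp [inner_sub_right, inner_smul_right, he]
  have h2 : ι (b.repr ⟨_, hmem⟩) = z - inner ℝ e z • e := by simp [ι]
  rw [← h2]
  congr 1
  refine ext_inner_right ℝ fun w => ?_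
  rw [ContinuousLinearMap.adjoint_inner_left, ← ι.inner_map_map, h2]
  have h3 : inner ℝ e (ι w) = 0 := by rw [real_inner_comm, h1]
  rw [inner_sub_left, inner_smul_left, h3]
  simp

/-- Inverse function theorem for `z ↦ (π z, τ z)`, where `π` projects along `e = ν p` and `τ` is a
local defining function of `S`. -/
lemma exists_graphChart (hS : IsSmoothHypersurface S) (hν : IsUnitNormal S ν) (hp : p ∈ S) :
    ∃ c : GraphChart S ν, p ∈ c.V := by
  obtain ⟨τ, U, Φ', Ψ', hU, hpU, hτ, hSU, hτ', h1, -, hT⟩ := hS.exists_slice hp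
  have he := hν.norm_eq_one p hp
  obtain ⟨ι, π, hι, hιπ⟩ := exists_isometry_orthogonal he
  let F : Amb n → EuclideanSpace ℝ (Fin n) × ℝ := fun z => (π z, τ z)
  let L : Amb n →L[ℝ] EuclideanSpace ℝ (Fin n) × ℝ :=
    π.prod ((ContinuousLinearMap.snd ℝ _ _).comp Φ')
  have hL : Function.Injective L := by
    rw [injective_iff_map_eq_zero]
    intro z hz
    have hz1 : π z = 0 := congrArg Prod.fst hz
    have hz2 : (Φ' z).2 = 0 := congrArg Prod.snd hz
    have hzT : z ∈ tangentSpaceAt S p := by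
      have h2 := hT (Φ' z).1
      rwa [show ((Φ' z).1, (0 : ℝ)) = Φ' z from Prod.ext rfl hz2.symm, h1] at h2
    have h3 := hιπ z
    rw [hz1, hν.normal p hp z hzT] at h3
    simpa using h3.symm
  let Le : Amb n ≃L[ℝ] EuclideanSpace ℝ (Fin n) × ℝ :=
    (LinearEquiv.ofInjectiveOfFinrankEq (L : Amb n →ₗ[ℝ] _) hL (by simp)).toContinuousLinearEquiv
  have hF : ContDiffOn ℝ 2 F U :=
    π.contDiff.contDiffOn.prodMk (contDiffOn_infty.1 hτ 2)
  have hFat : ContDiffAt ℝ 2 F p := hF.contDiffAt (hU.mem_nhds hpU)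
  have hFd : HasFDerivAt F (Le : Amb n →L[ℝ] _) p := by
    have : HasFDerivAt F L p := π.hasFDerivAt.prodMk hτ'
    exact this
  have hFp : F p = (π p, 0) := Prod.ext rfl ((hSU p hpU).1 hp)
  let H := hFat.toOpenPartialHomeomorph F hFd (by simp)
  have hpH : p ∈ H.source := hFat.mem_toOpenPartialHomeomorph_source hFd (by simp)
  have hHF : ∀ z, H z = F z := fun _ => rfl
  have hinv : ContDiffAt ℝ 2 H.symm (F p) := hFat.to_localInverse hFd (by simp)
  obtain ⟨T, hTsub, hTo, hFpT⟩ :=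
    mem_nhds_iff.1 (Filter.inter_mem (H.open_target.mem_nhds (H.map_source hpH))
      (Filter.inter_mem (hinv.eventually (by simp))
        (hinv.continuousAt.preimage_mem_nhds (hU.mem_nhds
          (by rw [← hHF, H.left_inv hpH]; exact hpU)))))
  let j : EuclideanSpace ℝ (Fin n) → EuclideanSpace ℝ (Fin n) × ℝ := fun x => (x, 0)
  have hj : ContDiff ℝ 2 j := contDiff_id.prodMk contDiff_const
  let G : EuclideanSpace ℝ (Fin n) → Amb n := fun x => H.symm (j x)
  let W₀ := j ⁻¹' T
  have hW₀ : IsOpen W₀ := hTo.preimage hj.continuous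
  have hG : ContDiffOn ℝ 2 G W₀ := fun x hx =>
    ((show ContDiffAt ℝ 2 H.symm (j x) from (hTsub hx).2.1).comp x hj.contDiffAt).contDiffWithinAt
  have hFG : ∀ x ∈ W₀, F (G x) = j x := fun x hx => H.right_inv (hTsub hx).1
  have hGS : ∀ x ∈ W₀, G x ∈ S := fun x hx =>
    (hSU _ (hTsub hx).2.2).2 (congrArg Prod.snd (hFG x hx))
  let κ : EuclideanSpace ℝ (Fin n) → ℝ := fun x => inner ℝ (ν (G x)) (ν p)
  have hκ : ContinuousOn κ W₀ :=
    (hν.smooth.continuousOn.comp hG.continuousOn hGS).inner continuousOn_const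
  let W := W₀ ∩ κ ⁻¹' Set.Ioi 0
  have hW : IsOpen W := hκ.isOpen_inter_preimage hW₀ isOpen_Ioi
  have hVG : ∀ z ∈ S ∩ U, z ∈ H.source → G (π z) = z := by
    intro z hz hzH
    have : j (π z) = H z := by
      rw [hHF]; exact Prod.ext rfl ((hSU z hz.2).1 hz.1).symm
    simp only [G, this]
    exact H.left_inv hzH
  have hπG : ∀ x ∈ W₀, π (G x) = x := fun x hx => congrArg Prod.fst (hFG x hx)
  refine ⟨⟨ι, π, ν p, W, H.source ∩ U ∩ π ⁻¹' W, G, he, hι, hιπ, hW,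
    (H.open_source.inter hU).inter (hW.preimage π.continuous),
    hG.mono Set.inter_subset_left, fun x hx => hGS x hx.1, fun x hx => ⟨⟨?_, ?_⟩, ?_⟩,
    fun x hx => hπG x hx.1, fun z hz => hz.2.2,
    fun z hz => hVG z ⟨hz.1, hz.2.1.2⟩ hz.2.1.1, fun x hx => hx.2⟩, ⟨hpH, hpU⟩, ?_, ?_⟩
  · exact H.map_target (hTsub hx.1).1
  · exact (hTsub hx.1).2.2
  · change π (G x) ∈ W
    rwa [hπG x hx.1]
  · change j (π p) ∈ T
    rwa [hHF, hFp] at hFpT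
  · change 0 < κ (π p)
    simp only [κ, hVG p ⟨hp, hpU⟩ hpH, real_inner_self_eq_norm_sq, he]
    norm_num

/-! ### Calculus on a hypersurface -/

section Calculus

variable {F : Type*} [NormedAddCommGroup F] [NormedSpace ℝ F]

namespace GraphChart

variable (c : GraphChart S ν) {x : EuclideanSpace ℝ (Fin n)}

lemma inner_π (z : Amb n) (w : EuclideanSpace ℝ (Fin n)) :
    inner ℝ (c.π z) w = inner ℝ z (c.ι w) := by
  have h : inner ℝ c.e (c.ι w) = 0 := by rw [real_inner_comm, c.inner_e]
  rw [← c.ι.inner_map_map, c.ι_π, inner_sub_left, inner_smul_left, h]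
  simp

lemma π_e : c.π c.e = 0 := by
  refine c.ι.injective ?_
  rw [c.ι_π, real_inner_self_eq_norm_sq, c.norm_e]
  simp

lemma hasFDerivAt_G (hx : x ∈ c.W) : HasFDerivAt c.G (fderiv ℝ c.G x) x :=
  ((c.contDiffOn_G.contDiffAt (c.isOpen_W.mem_nhds hx)).differentiableAt (by simp)).hasFDerivAt

lemma π_fderiv_G (hx : x ∈ c.W) (w : EuclideanSpace ℝ (Fin n)) :
    c.π (fderiv ℝ c.G x w) = w := by
  have h1 := c.π.hasFDerivAt.comp x (c.hasFDerivAt_G hx)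
  have h2 : HasFDerivAt (c.π ∘ c.G) (ContinuousLinearMap.id ℝ _) x :=
    (hasFDerivAt_id x).congr_of_eventuallyEq
      (Filter.eventuallyEq_of_mem (c.isOpen_W.mem_nhds hx) c.π_G)
  exact congrArg (fun L : _ →L[ℝ] _ => L w) (h1.unique h2)

lemma inner_normal_fderiv_G (hν : IsUnitNormal S ν) (hx : x ∈ c.W)
    (w : EuclideanSpace ℝ (Fin n)) : inner ℝ (ν (c.G x)) (fderiv ℝ c.G x w) = 0 := by
  refine hν.normal _ (c.G_mem x hx) _ (Submodule.subset_span ?_)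
  have h := (c.hasFDerivAt_G hx).hasFDerivWithinAt (s := c.W) |>.mapsTo_tangent_cone
  rw [tangentConeAt_of_mem_nhds (c.isOpen_W.mem_nhds hx)] at h
  exact tangentConeAt_mono (Set.image_subset_iff.2 c.G_mem) (h (Set.mem_univ w))

/-- A tangent vector is determined by its projection to the parameter space. -/
lemma eq_of_π_eq (hx : x ∈ c.W) {z z' : Amb n} (hz : inner ℝ (ν (c.G x)) z = 0)
    (hz' : inner ℝ (ν (c.G x)) z' = 0) (h : c.π z = c.π z') : z = z' := by
  have h1 : z - z' = inner ℝ c.e (z - z') • c.e := by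
    have := c.ι_π (z - z')
    rw [map_sub, h, sub_self, map_zero] at this
    exact sub_eq_zero.1 this.symm
  have h2 : inner ℝ (ν (c.G x)) (z - z') = 0 := by rw [inner_sub_right, hz, hz', sub_self]
  rw [h1, inner_smul_right] at h2
  rcases mul_eq_zero.1 h2 with h3 | h3
  · rw [h3, zero_smul] at h1
    exact sub_eq_zero.1 h1
  · exact absurd h3 (c.inner_pos x hx).ne'

lemma fderiv_G_π (hν : IsUnitNormal S ν) (hx : x ∈ c.W) {z : Amb n}
    (hz : inner ℝ (ν (c.G x)) z = 0) : fderiv ℝ c.G x (c.π z) = z :=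
  c.eq_of_π_eq hx (c.inner_normal_fderiv_G hν hx _) hz (c.π_fderiv_G hx _)

lemma hasFDerivAt_comp (hx : x ∈ c.W) {f : Amb n → F} {f' : Amb n →L[ℝ] F}
    (hf : HasFDerivWithinAt f f' S (c.G x)) :
    HasFDerivAt (f ∘ c.G) (f'.comp (fderiv ℝ c.G x)) x :=
  (hf.comp x (c.hasFDerivAt_G hx).hasFDerivWithinAt c.G_mem).hasFDerivAt
    (c.isOpen_W.mem_nhds hx)

lemma eventually_G_π (hx : x ∈ c.W) : ∀ᶠ z in nhdsWithin (c.G x) S, c.G (c.π z) = z := by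
  filter_upwards [self_mem_nhdsWithin,
    mem_nhdsWithin_of_mem_nhds (c.isOpen_V.mem_nhds (c.G_mem_V x hx))] with z hz hz'
  exact c.G_π z ⟨hz, hz'⟩

/-- A function on `S` extends locally by a function constant in the direction of `e`; the derivative
of the extension is a derivative within `S`. -/
lemma hasFDerivWithinAt_of_comp (hx : x ∈ c.W) {f : Amb n → F}
    {L : EuclideanSpace ℝ (Fin n) →L[ℝ] F} (hf : HasFDerivAt (f ∘ c.G) L x) :
    HasFDerivWithinAt f (L.comp c.π) S (c.G x) := by
  have hf' : HasFDerivAt (f ∘ c.G) L (c.π (c.G x)) := by rwa [c.π_G x hx]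
  refine (hf'.comp (c.G x) c.π.hasFDerivAt).hasFDerivWithinAt.congr_of_eventuallyEq ?_ ?_
  · filter_upwards [c.eventually_G_π hx] with z hz
    simp [hz]
  · simp [c.π_G x hx]

lemma contDiffOn_comp {k : ℕ∞ω} (hk : k ≤ 2) {f : Amb n → F} (hf : ContDiffOn ℝ k f S) :
    ContDiffOn ℝ k (f ∘ c.G) c.W :=
  hf.comp (c.contDiffOn_G.of_le hk) c.G_mem

lemma hasFDerivAt_fderiv_comp {f : Amb n → F} (hf : ContDiffOn ℝ 1 f S) (hx : x ∈ c.W) :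
    HasFDerivAt (f ∘ c.G) (fderiv ℝ (f ∘ c.G) x) x :=
  (((c.contDiffOn_comp (by norm_num) hf).contDiffAt (c.isOpen_W.mem_nhds hx)).differentiableAt
    (by simp)).hasFDerivAt

lemma tangentDeriv_apply (hS : IsSmoothHypersurface S) (hν : IsUnitNormal S ν) (hx : x ∈ c.W)
    {f : Amb n → F} (hf : ContDiffOn ℝ 1 f S) (w : Amb n) :
    tangentDeriv S f (c.G x) w
      = fderiv ℝ (f ∘ c.G) x (c.π w - inner ℝ (ν (c.G x)) w • c.π (ν (c.G x))) := by
  rw [tangentDeriv_eq (c.hasFDerivWithinAt_of_comp hx (c.hasFDerivAt_fderiv_comp hf hx))]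
  simp [hν.tangentProj_apply hS (c.G_mem x hx)]

end GraphChart

/-- Regularity on `S` may be checked in graph charts. -/
lemma contDiffOn_of_graphChart {k : ℕ∞ω} (hS : IsSmoothHypersurface S)
    (hν : IsUnitNormal S ν) {f : Amb n → F}
    (hf : ∀ c : GraphChart S ν, ContDiffOn ℝ k (f ∘ c.G) c.W) : ContDiffOn ℝ k f S := by
  intro p hp
  obtain ⟨c, hpc⟩ := exists_graphChart hS hν hp
  have hx := c.π_mem p ⟨hp, hpc⟩
  have hGp := c.G_π p ⟨hp, hpc⟩
  have h1 : ContDiffAt ℝ k (f ∘ c.G) (c.π p) := (hf c).contDiffAt (c.isOpen_W.mem_nhds hx)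
  refine (h1.comp p c.π.contDiff.contDiffAt).contDiffWithinAt.congr_of_eventuallyEq ?_ ?_
  · have := c.eventually_G_π hx
    rw [hGp] at this
    filter_upwards [this] with z hz
    simp [hz]
  · simp [hGp]

section Regularity

variable (hS : IsSmoothHypersurface S) (hν : IsUnitNormal S ν)
include hS hν

lemma contDiffOn_tangentDeriv {k : ℕ∞ω} (hk : k + 1 ≤ 2) {f : Amb n → F}
    (hf : ContDiffOn ℝ (k + 1) f S) (w : Amb n) :
    ContDiffOn ℝ k (fun p => tangentDeriv S f p w) S := by
  have hk2 : k ≤ 2 := le_self_add.trans hk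
  refine contDiffOn_of_graphChart hS hν fun c => ?_
  have hνG : ContDiffOn ℝ k (ν ∘ c.G) c.W :=
    c.contDiffOn_comp hk2 ((contDiffOn_infty.1 hν.smooth 2).of_le hk2)
  have hfG : ContDiffOn ℝ k (fderiv ℝ (f ∘ c.G)) c.W :=
    (c.contDiffOn_comp hk hf).fderiv_of_isOpen c.isOpen_W le_rfl
  have h : ContDiffOn ℝ k (fun x => fderiv ℝ (f ∘ c.G) x
      (c.π w - inner ℝ ((ν ∘ c.G) x) w • c.π ((ν ∘ c.G) x))) c.W :=
    hfG.clm_apply (contDiffOn_const.sub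
      ((hνG.inner ℝ contDiffOn_const).smul (c.π.contDiff.comp_contDiffOn hνG)))
  exact h.congr fun x hx =>
    c.tangentDeriv_apply hS hν hx (hf.of_le le_add_self) w

end Regularity

lemma inner_grad (S : Set (Amb n)) (φ : Amb n → ℝ) (p w : Amb n) :
    inner ℝ (grad S φ p) w = tangentDeriv S φ p w := by
  simp [grad]

lemma inner_grad' (S : Set (Amb n)) (φ : Amb n → ℝ) (p w : Amb n) :
    inner ℝ w (grad S φ p) = tangentDeriv S φ p w := by
  rw [real_inner_comm, inner_grad]

lemma contDiffOn_grad (hS : IsSmoothHypersurface S) (hν : IsUnitNormal S ν) {k : ℕ∞ω}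
    (hk : k + 1 ≤ 2) {φ : Amb n → ℝ} (hφ : ContDiffOn ℝ (k + 1) φ S) :
    ContDiffOn ℝ k (grad S φ) S := by
  rw [contDiffOn_euclidean]
  intro i
  refine (contDiffOn_tangentDeriv hS hν hk hφ (EuclideanSpace.single i 1)).congr fun p _ => ?_
  rw [← inner_grad, EuclideanSpace.inner_single_right]
  simp

/-- The derivative of the unit normal is tangential. -/
lemma inner_normal_shape (hν : IsUnitNormal S ν) (hp : p ∈ S) (w : Amb n) :
    inner ℝ (ν p) (tangentDeriv S ν p w) = 0 := by
  have hd : DifferentiableWithinAt ℝ ν S p := (hν.smooth p hp).differentiableWithinAt (by simp)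
  have h1 := hd.hasFDerivWithinAt.inner ℝ hd.hasFDerivWithinAt
  have h2 : HasFDerivWithinAt (fun q => inner ℝ (ν q) (ν q)) (0 : Amb n →L[ℝ] ℝ) S p :=
    (hasFDerivWithinAt_const (1 : ℝ) p S).congr
      (fun q hq => by rw [real_inner_self_eq_norm_sq, hν.norm_eq_one q hq]; norm_num)
      (by rw [real_inner_self_eq_norm_sq, hν.norm_eq_one p hp]; norm_num)
  have h3 := (tangentDeriv_eq h1).symm.trans (tangentDeriv_eq h2)
  have h4 := congrArg (fun L : Amb n →L[ℝ] ℝ => L w) h3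
  simp [fderivInnerCLM_apply] at h4
  rw [real_inner_comm (ν p)] at h4
  have h5 : inner ℝ (ν p) ((fderivWithin ℝ ν S p) (tangentProj S p w)) = 0 := by linarith
  exact h5

section Pointwise

variable (hS : IsSmoothHypersurface S) (hν : IsUnitNormal S ν) (hp : p ∈ S)
include hS hν hp

lemma tangentProj_normal : tangentProj S p (ν p) = 0 := by
  simp [hν.tangentProj_apply hS hp, hν.norm_eq_one p hp]

lemma tangentDeriv_normal (f : Amb n → F) : tangentDeriv S f p (ν p) = 0 := by
  simp [tangentDeriv, tangentProj_normal hS hν hp]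

lemma inner_normal_grad (φ : Amb n → ℝ) : inner ℝ (ν p) (grad S φ p) = 0 := by
  rw [inner_grad', tangentDeriv_normal hS hν hp]

lemma inner_normal_tangentProj (w : Amb n) : inner ℝ (ν p) (tangentProj S p w) = 0 := by
  simp [hν.tangentProj_apply hS hp, inner_sub_right, inner_smul_right, hν.norm_eq_one p hp]

lemma tangentProj_of_tangent {w : Amb n} (hw : inner ℝ (ν p) w = 0) : tangentProj S p w = w := by
  simp [hν.tangentProj_apply hS hp, hw]

/-- The second fundamental form is symmetric: in a graph chart it is `-⟨ν, D²G⟩`. -/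
lemma shape_symm (u w : Amb n) :
    inner ℝ (tangentDeriv S ν p u) w = inner ℝ u (tangentDeriv S ν p w) := by
  obtain ⟨c, hpc⟩ := exists_graphChart hS hν hp
  have hx := c.π_mem p ⟨hp, hpc⟩
  have hGp := c.G_π p ⟨hp, hpc⟩
  set x := c.π p with hxdef
  have hGat : ContDiffAt ℝ 2 c.G x := c.contDiffOn_G.contDiffAt (c.isOpen_W.mem_nhds hx)
  have hG2 : HasFDerivAt (fderiv ℝ c.G) (fderiv ℝ (fderiv ℝ c.G) x) x :=
    ((hGat.fderiv_right (m := 1) (by norm_num)).differentiableAt (by simp)).hasFDerivAt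
  have hνd : HasFDerivWithinAt ν (fderivWithin ℝ ν S p) S (c.G x) := by
    rw [hGp]
    exact ((hν.smooth p hp).differentiableWithinAt (by simp)).hasFDerivWithinAt
  have hνG := c.hasFDerivAt_comp hx hνd
  have hsym : ∀ a b, inner ℝ (fderivWithin ℝ ν S p (fderiv ℝ c.G x a)) (fderiv ℝ c.G x b)
      = - inner ℝ (ν p) (fderiv ℝ (fderiv ℝ c.G) x a b) := by
    intro a b
    have h1 := hνG.inner ℝ (hG2.clm_apply (hasFDerivAt_const b x))
    have h2 : HasFDerivAt (fun y => inner ℝ ((ν ∘ c.G) y) (fderiv ℝ c.G y b))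
        (0 : _ →L[ℝ] ℝ) x :=
      (hasFDerivAt_const (0 : ℝ) x).congr_of_eventuallyEq
        (Filter.eventuallyEq_of_mem (c.isOpen_W.mem_nhds hx)
          fun y hy => c.inner_normal_fderiv_G hν hy b)
    have h3 := congrArg (fun L : _ →L[ℝ] ℝ => L a) (h1.unique h2)
    simp [fderivInnerCLM_apply, hGp] at h3
    linarith
  have hs2 : IsSymmSndFDerivAt ℝ c.G x := hGat.isSymmSndFDerivAt (by simp)
  have key : ∀ a b, inner ℝ (ν p) a = 0 → inner ℝ (ν p) b = 0 →
      inner ℝ (fderivWithin ℝ ν S p a) b = inner ℝ (fderivWithin ℝ ν S p b) a := by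
    intro a b ha hb
    rw [← hGp] at ha hb
    have h1 := hsym (c.π a) (c.π b)
    have h2 := hsym (c.π b) (c.π a)
    rw [c.fderiv_G_π hν hx ha, c.fderiv_G_π hν hx hb] at h1 h2
    rw [h1, h2, hs2.eq]
  have hN := inner_normal_tangentProj hS hν hp
  have h1 : ∀ u w, inner ℝ (tangentDeriv S ν p u) w
      = inner ℝ (fderivWithin ℝ ν S p (tangentProj S p u)) (tangentProj S p w) := by
    intro u w
    have h2 := inner_normal_shape hν hp u
    rw [hν.tangentProj_apply hS hp w, inner_sub_right, inner_smul_right]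
    change _ = inner ℝ (tangentDeriv S ν p u) w - _ * inner ℝ (tangentDeriv S ν p u) (ν p)
    rw [real_inner_comm, real_inner_comm (ν p), h2]
    simp
  rw [h1, key _ _ (hN u) (hN w), ← h1, real_inner_comm]

lemma secondFF_eq (u w : Amb n) : secondFF S ν p u w = inner ℝ (tangentDeriv S ν p u) w := by
  unfold secondFF
  rw [hν.tangentProj_apply hS hp, inner_sub_right, inner_smul_right,
    real_inner_comm (ν p) (tangentDeriv S ν p u), inner_normal_shape hν hp]
  simp

/-- The divergence along `S` in terms of any derivative within `S`. -/
lemma surfDiv_eq {V : Amb n → Amb n} {V' : Amb n →L[ℝ] Amb n}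
    (hV : HasFDerivWithinAt V V' S p) :
    surfDiv S V p = LinearMap.trace ℝ (Amb n) V' - inner ℝ (ν p) (V' (ν p)) := by
  unfold surfDiv
  rw [tangentDeriv_eq hV]
  have h1 : ((tangentProj S p).comp (V'.comp (tangentProj S p)) : Amb n →ₗ[ℝ] Amb n)
      = (tangentProj S p : Amb n →ₗ[ℝ] Amb n) ∘ₗ (V'.comp (tangentProj S p) : Amb n →L[ℝ] Amb n) :=
    rfl
  have h2 : ((V'.comp (tangentProj S p) : Amb n →L[ℝ] Amb n) : Amb n →ₗ[ℝ] Amb n)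
      ∘ₗ (tangentProj S p : Amb n →ₗ[ℝ] Amb n)
      = (V' : Amb n →ₗ[ℝ] Amb n) - (InnerProductSpace.rankOne ℝ (V' (ν p)) (ν p) : _ →L[ℝ] _) := by
    ext1 w
    simp only [LinearMap.comp_apply, ContinuousLinearMap.coe_coe, ContinuousLinearMap.comp_apply,
      LinearMap.sub_apply, InnerProductSpace.rankOne_apply]
    rw [tangentProj_of_tangent hS hν hp (inner_normal_tangentProj hS hν hp w),
      hν.tangentProj_apply hS hp, map_sub, map_smul]
  rw [h1, LinearMap.trace_comp_comm', h2, map_sub, InnerProductSpace.trace_rankOne]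

lemma surfDiv_smul {f : Amb n → ℝ} {V : Amb n → Amb n} (hf : DifferentiableWithinAt ℝ f S p)
    (hV : DifferentiableWithinAt ℝ V S p) (hVt : inner ℝ (ν p) (V p) = 0) :
    surfDiv S (fun q => f q • V q) p = f p * surfDiv S V p + inner ℝ (grad S f p) (V p) := by
  have h0 : HasFDerivWithinAt (fun q => f q • V q) _ S p :=
    hf.hasFDerivWithinAt.smul hV.hasFDerivWithinAt
  rw [surfDiv_eq hS hν hp h0,
    surfDiv_eq hS hν hp hV.hasFDerivWithinAt, inner_grad, tangentDeriv]
  have h1 : LinearMap.trace ℝ (Amb n)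
      ((fderivWithin ℝ f S p).smulRight (V p) : Amb n →L[ℝ] Amb n)
      = fderivWithin ℝ f S p (V p) := by
    exact LinearMap.trace_smulRight _ _
  simp only [ContinuousLinearMap.toLinearMap_add, ContinuousLinearMap.toLinearMap_smul,
    map_add, map_smul, h1,
    add_apply, smul_apply, inner_add_right,
    inner_smul_right, ContinuousLinearMap.smulRight_apply, hVt, smul_eq_mul,
    ContinuousLinearMap.comp_apply, tangentProj_of_tangent hS hν hp hVt]
  ring

end Pointwise

lemma surfDiv_congr {V V' : Amb n → Amb n} (h : Set.EqOn V V' S) (hp : p ∈ S) :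
    surfDiv S V p = surfDiv S V' p := by
  unfold surfDiv
  rw [tangentDeriv_congr h hp]

end Calculus

/-! ### The Jacobi equation on a self-shrinker -/

lemma normSqA_eq_trace (hS : IsSmoothHypersurface S) (hν : IsUnitNormal S ν) (hp : p ∈ S) :
    normSqA S ν p = LinearMap.trace ℝ (Amb n)
      ((tangentDeriv S ν p).comp (tangentDeriv S ν p) : Amb n →L[ℝ] Amb n) := by
  rw [LinearMap.trace_eq_sum_inner _ (EuclideanSpace.basisFun (Fin (n + 1)) ℝ)]
  unfold normSqA
  refine Finset.sum_congr rfl fun i _ => ?_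
  rw [ContinuousLinearMap.coe_coe, ContinuousLinearMap.comp_apply, ← shape_symm hS hν hp,
    real_inner_self_eq_norm_sq, EuclideanSpace.real_norm_sq_eq]
  refine Finset.sum_congr rfl fun j _ => ?_
  rw [secondFF_eq hS hν hp, EuclideanSpace.inner_single_right]
  simp

/-- The trace as a continuous linear functional. -/
noncomputable def traceCLM (n : ℕ) : (Amb n →L[ℝ] Amb n) →L[ℝ] ℝ :=
  LinearMap.toContinuousLinearMap
    ((LinearMap.trace ℝ (Amb n)).comp (ContinuousLinearMap.coeLM ℝ))

lemma traceCLM_apply (T : Amb n →L[ℝ] Amb n) :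
    traceCLM n T = LinearMap.trace ℝ (Amb n) (T : Amb n →ₗ[ℝ] Amb n) := rfl

lemma traceCLM_smulRight (l : Amb n →L[ℝ] ℝ) (v : Amb n) :
    traceCLM n (l.smulRight v) = l v :=
  LinearMap.trace_smulRight _ _

lemma grad_inner_normal (hS : IsSmoothHypersurface S) (hν : IsUnitNormal S ν) (hp : p ∈ S)
    (v : Amb n) : grad S (fun q => inner ℝ v (ν q)) p = tangentDeriv S ν p v := by
  refine ext_inner_right ℝ fun w => ?_
  rw [inner_grad, shape_symm hS hν hp]
  have hd : HasFDerivWithinAt ν (fderivWithin ℝ ν S p) S p :=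
    ((hν.smooth p hp).differentiableWithinAt (by simp)).hasFDerivWithinAt
  rw [tangentDeriv_eq ((hasFDerivWithinAt_const v p S).inner ℝ hd), tangentDeriv_eq hd]
  simp [fderivInnerCLM_apply]

/-- The Jacobi equation `Δu = ⟨∇H, v⟩ - |A|² u` for `u = ⟨v, ν⟩`, in the form that it takes on a
self-shrinker, where `∇H = A x / 2`. The normal field is extended to a neighbourhood of `p` by a
unit field `N`. The Codazzi equation becomes the symmetry of `D²N`, and the terms that contain the
derivative of `N` in the normal direction cancel. -/
lemma laplacian_inner_normal (hS : IsSelfShrinker S ν) (hp : p ∈ S) (v : Amb n) :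
    laplacian S (fun q => inner ℝ v (ν q)) p
      = (1 / 2) * inner ℝ p (grad S (fun q => inner ℝ v (ν q)) p)
        - normSqA S ν p * inner ℝ v (ν p) := by
  have hν := hS.unitNormal
  have hM := hS.hypersurface
  obtain ⟨c, hpc⟩ := exists_graphChart hM hν hp
  have hx := c.π_mem p ⟨hp, hpc⟩
  have hGp := c.G_π p ⟨hp, hpc⟩
  let N : Amb n → Amb n := fun z => ν (c.G (c.π z))
  have hNp : N p = ν p := by simp only [N, hGp]
  let O : Set (Amb n) := c.V ∩ c.π ⁻¹' c.W
  have hO : IsOpen O := c.isOpen_V.inter (c.isOpen_W.preimage c.π.continuous)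
  have hpO : p ∈ O := ⟨hpc, hx⟩
  have hNO : ContDiffOn ℝ 2 N O :=
    (c.contDiffOn_comp le_rfl (contDiffOn_infty.1 hν.smooth 2)).comp c.π.contDiff.contDiffOn
      (fun z hz => hz.2)
  have hN1 : ∀ z ∈ O, HasFDerivAt N (fderiv ℝ N z) z := fun z hz =>
    ((hNO.contDiffAt (hO.mem_nhds hz)).differentiableAt (by simp)).hasFDerivAt
  have hN2 : HasFDerivAt (fderiv ℝ N) (fderiv ℝ (fderiv ℝ N) p) p :=
    (((hNO.contDiffAt (hO.mem_nhds hpO)).fderiv_right (m := 1) (by norm_num)).differentiableAt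
      (by simp)).hasFDerivAt
  have hsym : IsSymmSndFDerivAt ℝ N p :=
    (hNO.contDiffAt (hO.mem_nhds hpO)).isSymmSndFDerivAt (by simp)
  set N₁ := fderiv ℝ N p with hN₁
  set N₂ := fderiv ℝ (fderiv ℝ N) p with hN₂
  have hNS : ∀ q ∈ S ∩ O, N q = ν q := fun q hq => by
    simp only [N, c.G_π q ⟨hq.1, hq.2.1⟩]
  have hSO : ∀ q ∈ S ∩ O, S ∩ O ∈ nhdsWithin q S := fun q hq =>
    Filter.inter_mem self_mem_nhdsWithin (mem_nhdsWithin_of_mem_nhds (hO.mem_nhds hq.2))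
  have hνd : ∀ q ∈ S ∩ O, HasFDerivWithinAt ν (fderiv ℝ N q) S q := fun q hq =>
    (hN1 q hq.2).hasFDerivWithinAt.congr_of_eventuallyEq
      (Filter.eventuallyEq_of_mem (hSO q hq) fun z hz => (hNS z hz).symm) (hNS q hq).symm
  have hpSO : p ∈ S ∩ O := ⟨hp, hpO⟩
  -- `N` has unit length on all of `O`
  have hunit : ∀ z ∈ O, ∀ w, inner ℝ (N z) (fderiv ℝ N z w) = 0 := by
    intro z hz w
    have h1 := (hN1 z hz).inner ℝ (hN1 z hz)
    have h2 : HasFDerivAt (fun z => inner ℝ (N z) (N z)) (0 : Amb n →L[ℝ] ℝ) z :=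
      (hasFDerivAt_const (1 : ℝ) z).congr_of_eventuallyEq
        (Filter.eventuallyEq_of_mem (hO.mem_nhds hz) fun y hy => by
          simp [N, hν.norm_eq_one _ (c.G_mem _ hy.2)])
    have h3 := congrArg (fun L : _ →L[ℝ] ℝ => L w) (h1.unique h2)
    simp [fderivInnerCLM_apply] at h3
    rw [real_inner_comm (N z)] at h3
    linarith
  have hunit₁ : ∀ w, inner ℝ (ν p) (N₁ w) = 0 := fun w => hNp ▸ hunit p hpO w
  have hunit₂ : ∀ a w, inner ℝ (ν p) (N₂ a w) = - inner ℝ (N₁ a) (N₁ w) := by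
    intro a w
    have h1 := (hN1 p hpO).inner ℝ (hN2.clm_apply (hasFDerivAt_const w p))
    have h2 : HasFDerivAt (fun z => inner ℝ (N z) (fderiv ℝ N z w)) (0 : Amb n →L[ℝ] ℝ) p :=
      (hasFDerivAt_const (0 : ℝ) p).congr_of_eventuallyEq
        (Filter.eventuallyEq_of_mem (hO.mem_nhds hpO) fun y hy => hunit y hy w)
    have h3 := congrArg (fun L : _ →L[ℝ] ℝ => L a) (h1.unique h2)
    simp [fderivInnerCLM_apply, hNp] at h3
    linarith
  have hB : ∀ w, tangentDeriv S ν p w = N₁ (tangentProj S p w) := fun w => by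
    rw [tangentDeriv_eq (hνd p hpSO)]; rfl
  -- as `N` has unit length, the mean curvature is the trace of `DN`
  -- along `S`, so its tangential derivative is known from the shrinker equation
  have hH : ∀ t, inner ℝ (ν p) t = 0 → traceCLM n (N₂ t) = (1 / 2) * inner ℝ p (N₁ t) := by
    intro t ht
    have hH1 : HasFDerivWithinAt (meanCurv S ν) ((traceCLM n).comp N₂) S p := by
      have hmc : ∀ q ∈ S ∩ O, meanCurv S ν q = traceCLM n (fderiv ℝ N q) := by
        intro q hq
        rw [meanCurv, surfDiv_eq hM hν hq.1 (hνd q hq), ← hNS q hq, hunit q hq.2, sub_zero]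
        rfl
      exact ((traceCLM n).hasFDerivAt.comp p hN2).hasFDerivWithinAt.congr_of_eventuallyEq
        (Filter.eventuallyEq_of_mem (hSO p hpSO) hmc) (hmc p hpSO)
    have hH2 := (((hasFDerivWithinAt_id p S).inner ℝ (hνd p hpSO)).const_mul
      (1 / 2)).congr hS.shrinker (hS.shrinker p hp)
    have h3 := congrArg (fun L : _ →L[ℝ] ℝ => L t)
      ((tangentDeriv_eq hH1).symm.trans (tangentDeriv_eq hH2))
    simp only [ContinuousLinearMap.comp_apply, tangentProj_of_tangent hM hν hp ht] at h3
    rw [h3]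
    simp [fderivInnerCLM_apply, real_inner_comm (ν p) t, ht, N₁]
  let V : Amb n → Amb n := fun z => fderiv ℝ N z (v - inner ℝ (N z) v • N z)
  have hgrad : ∀ q ∈ S ∩ O, grad S (fun q => inner ℝ v (ν q)) q = V q := by
    intro q hq
    rw [grad_inner_normal hM hν hq.1, tangentDeriv_eq (hνd q hq),
      ContinuousLinearMap.comp_apply, hν.tangentProj_apply hM hq.1]
    simp only [V, hNS q hq]
  -- on `S` the gradient is `V`, which is differentiable near `p` in the ambient space
  have hVd := hN2.clm_apply ((hasFDerivAt_const v p).sub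
    (((hN1 p hpO).inner ℝ (hasFDerivAt_const v p)).smul (hN1 p hpO)))
  have hVS := hVd.hasFDerivWithinAt.congr_of_eventuallyEq
    (Filter.eventuallyEq_of_mem (hSO p hpSO) hgrad) (hgrad p hpSO)
  set Pv := tangentProj S p v with hPv
  have hPv' : Pv = v - inner ℝ (ν p) v • ν p := hν.tangentProj_apply hM hp v
  rw [laplacian, surfDiv_eq hM hν hp hVS, hgrad p hpSO]
  have htr : ∀ T : Amb n →L[ℝ] Amb n, (∀ a, T a = N₂ Pv a - inner ℝ (N₁ a) v • N₁ (ν p)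
      - inner ℝ (ν p) v • N₁ (N₁ a)) →
      LinearMap.trace ℝ (Amb n) (T : Amb n →ₗ[ℝ] Amb n) - inner ℝ (ν p) (T (ν p))
      = (1 / 2) * inner ℝ p (N₁ Pv) - inner ℝ (ν p) v * traceCLM n (N₁.comp N₁) := by
    intro T hT
    have hT' : T = N₂ Pv - ((innerSL ℝ v).comp N₁).smulRight (N₁ (ν p))
        - inner ℝ (ν p) v • N₁.comp N₁ := by
      ext1 a
      simp [hT, real_inner_comm v]
    rw [← traceCLM_apply, hT (ν p), hT', map_sub, map_sub, map_smul, traceCLM_smulRight,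
      hH Pv (inner_normal_tangentProj hM hν hp v), inner_sub_right, inner_sub_right, hunit₂,
      inner_smul_right, inner_smul_right, hunit₁, hunit₁]
    -- by symmetry of the shape operator, the two terms with the normal derivative `N₁ (ν p)` agree
    have h5 := shape_symm hM hν hp (N₁ (ν p)) v
    rw [hB, hB, tangentProj_of_tangent hM hν hp (hunit₁ _), ← hPv] at h5
    simp only [ContinuousLinearMap.comp_apply, innerSL_apply_apply, smul_eq_mul]
    rw [real_inner_comm (N₁ (N₁ (ν p))) v, h5, real_inner_comm (N₁ Pv) (N₁ (ν p))]
    ring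
  have hA : normSqA S ν p = traceCLM n (N₁.comp N₁) := by
    rw [normSqA_eq_trace hM hν hp]
    have h6 : (tangentDeriv S ν p).comp (tangentDeriv S ν p)
        = N₁.comp N₁ - (InnerProductSpace.rankOne ℝ (N₁ (N₁ (ν p))) (ν p) : _ →L[ℝ] _) := by
      ext1 a
      simp only [ContinuousLinearMap.comp_apply, hB, sub_apply,
        InnerProductSpace.rankOne_apply]
      rw [tangentProj_of_tangent hM hν hp (hunit₁ _), hν.tangentProj_apply hM hp, map_sub,
        map_sub, map_smul, map_smul]
    rw [h6, ← traceCLM_apply, map_sub, traceCLM_apply (InnerProductSpace.rankOne ℝ _ _),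
      InnerProductSpace.trace_rankOne, hunit₁, sub_zero]
  rw [htr, hA, real_inner_comm v]
  · simp only [V, hNp, ← hPv']
    ring
  · intro a
    rw [show N₂ Pv a = N₂ a Pv from hsym.eq _ _, hPv']
    simp [fderivInnerCLM_apply, hNp, ← hN₁]
    module

/-! ### The area formula -/

section AreaFormula

open scoped NNReal ENNReal

/-- If distances in the image of `f` are at most `K` times those in the image of `g`, then the
measures compare with the factor `K ^ d`. -/
lemma euclideanHausdorffMeasure_image_le {X Y Z : Type*} [EMetricSpace Y] [MeasurableSpace Y]
    [BorelSpace Y] [EMetricSpace Z] [MeasurableSpace Z] [BorelSpace Z] [Nonempty X] {f : X → Y}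
    {g : X → Z} {A : Set X} {K : ℝ≥0} (d : ℕ)
    (h : ∀ x ∈ A, ∀ y ∈ A, edist (f x) (f y) ≤ K * edist (g x) (g y)) :
    Measure.euclideanHausdorffMeasure d (f '' A)
      ≤ (K : ℝ≥0∞) ^ d * Measure.euclideanHausdorffMeasure d (g '' A) := by
  let k : Z → X := Function.invFunOn g A
  have hk : ∀ x ∈ A, k (g x) ∈ A ∧ g (k (g x)) = g x := fun x hx =>
    ⟨Function.invFunOn_mem ⟨x, hx, rfl⟩, Function.invFunOn_eq ⟨x, hx, rfl⟩⟩
  have hL : LipschitzOnWith K (f ∘ k) (g '' A) := by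
    rintro _ ⟨x, hx, rfl⟩ _ ⟨y, hy, rfl⟩
    have := h _ (hk x hx).1 _ (hk y hy).1
    rwa [(hk x hx).2, (hk y hy).2] at this
  have himg : (f ∘ k) '' (g '' A) = f '' A := by
    rw [← Set.image_comp]
    refine Set.image_congr fun x hx => ?_
    have := h _ (hk x hx).1 _ hx
    rw [(hk x hx).2, edist_self, mul_zero, nonpos_iff_eq_zero, edist_eq_zero] at this
    exact this
  have h1 := hL.hausdorffMeasure_image_le (d := d) (by positivity)
  rw [himg, ENNReal.rpow_natCast] at h1
  simp only [Measure.euclideanHausdorffMeasure_def, Measure.smul_apply, ENNReal.smul_def,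
    smul_eq_mul]
  calc _ ≤ _ * ((K : ℝ≥0∞) ^ d * _) := mul_le_mul_right h1 _
    _ = _ := mul_left_comm _ _ _

variable {E F : Type*} [NormedAddCommGroup E] [InnerProductSpace ℝ E] [FiniteDimensional ℝ E]
  [NormedAddCommGroup F] [InnerProductSpace ℝ F]

/-- Near a point, an immersion is bi-Lipschitz to its derivative with constants close to `1`. -/
lemma eventually_edist_le_of_hasStrictFDerivAt {f : E → F} {L : E →L[ℝ] F} {x : E}
    (hf : HasStrictFDerivAt f L x) (hL : Function.Injective L) {K : ℝ≥0} (hK : 1 < K) :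
    ∃ s ∈ 𝓝 x, ∀ y ∈ s, ∀ z ∈ s, edist (f y) (f z) ≤ K * edist (L y) (L z) ∧
      edist (L y) (L z) ≤ K * edist (f y) (f z) := by
  obtain ⟨κ, hκ, hanti⟩ :=
    (L : E →ₗ[ℝ] F).exists_antilipschitzWith (LinearMap.ker_eq_bot.2 hL)
  have hK0 : (0 : ℝ≥0) < K := zero_lt_one.trans hK
  have hδ : 0 < (K - 1) / K := div_pos (tsub_pos_of_lt hK) hK0
  obtain ⟨s, hs, happ⟩ := hf.approximates_deriv_on_nhds (c := (K - 1) / K / κ)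
    (Or.inr (div_pos hδ hκ))
  refine ⟨s, hs, fun y hy z hz => ?_⟩
  have hKr : (1 : ℝ) < K := by exact_mod_cast hK
  have h1 : ‖f y - f z - L (y - z)‖ ≤ ((K : ℝ) - 1) / K * ‖L y - L z‖ := by
    have h2 := happ y hy z hz
    have h3 : ‖y - z‖ ≤ κ * ‖L y - L z‖ := by
      simpa [dist_eq_norm] using hanti.le_mul_dist y z
    calc _ ≤ _ := h2
      _ ≤ ((K - 1) / K / κ : ℝ≥0) * (κ * ‖L y - L z‖) := by gcongr
      _ = _ := by
        have : (κ : ℝ) ≠ 0 := by exact_mod_cast hκ.ne'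
        push_cast [NNReal.coe_sub hK.le]
        field_simp
  rw [map_sub] at h1
  have h4 : ‖f y - f z‖ ≤ ‖f y - f z - (L y - L z)‖ + ‖L y - L z‖ := by
    simpa using norm_add_le (f y - f z - (L y - L z)) (L y - L z)
  have h5 : ‖L y - L z‖ ≤ ‖f y - f z - (L y - L z)‖ + ‖f y - f z‖ := by
    have := norm_sub_le (f y - f z) (f y - f z - (L y - L z))
    rw [sub_sub_cancel] at this
    linarith
  set t := ‖L y - L z‖
  have ht : 0 ≤ t := norm_nonneg _
  have h6 : ((K : ℝ) - 1) / K * t = t - t / K := by field_simp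
  rw [h6] at h1
  simp only [edist_nndist]
  norm_cast
  simp only [← NNReal.coe_le_coe, NNReal.coe_mul, coe_nndist, dist_eq_norm]
  constructor
  · change _ ≤ K * t
    have : t + t ≤ K * t + t / K := by
      have h7 : 0 ≤ t / K * (K - 1) ^ 2 := by positivity
      have h8 : t / K * ((K : ℝ) - 1) ^ 2 = K * t + t / K - (t + t) := by field_simp; ring
      linarith
    linarith
  · change t ≤ _
    have : t / K ≤ ‖f y - f z‖ := by linarith
    rwa [div_le_iff₀' (by positivity)] at this

variable [CompleteSpace F]

lemma continuous_normDet : Continuous fun L : E →L[ℝ] F => (L : E →ₗ[ℝ] F).normDet := by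
  have : CompleteSpace E := FiniteDimensional.complete ℝ E
  have h : ∀ L : E →L[ℝ] F, (L : E →ₗ[ℝ] F).normDet
      = Real.sqrt (L.adjoint.comp L).det := by
    intro L
    rw [← Real.sqrt_sq (LinearMap.normDet_nonneg (L : E →ₗ[ℝ] F))]
    congr 1
    exact L.normDet_sq
  simp_rw [h]
  refine (ContinuousLinearMap.continuous_det.comp ?_).sqrt
  exact (ContinuousLinearMap.adjoint (𝕜 := ℝ) (E := E) (F := F)).continuous.clm_comp continuous_id

variable [MeasurableSpace E] [BorelSpace E] [MeasurableSpace F] [BorelSpace F]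

local notation "μE" => Measure.euclideanHausdorffMeasure (Module.finrank ℝ E)

/-- Near a point, the area of the image of an immersion is comparable to the integral of its
Jacobian, with constants close to `1`. -/
lemma exists_nhds_area_le {f : E → F} {W : Set E} (hW : IsOpen W) (hf : ContDiffOn ℝ 1 f W)
    (hinj : ∀ x ∈ W, Function.Injective (fderiv ℝ f x)) {K : ℝ≥0} (hK : 1 < K) {x : E}
    (hx : x ∈ W) :
    ∃ s ∈ 𝓝 x, ∀ A, MeasurableSet A → A ⊆ s →
      μE (f '' A) ≤ (K : ℝ≥0∞) ^ (Module.finrank ℝ E + 1) *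
        ∫⁻ y in A, ENNReal.ofReal (fderiv ℝ f y : E →ₗ[ℝ] F).normDet ∧
      ∫⁻ y in A, ENNReal.ofReal (fderiv ℝ f y : E →ₗ[ℝ] F).normDet
        ≤ (K : ℝ≥0∞) ^ (Module.finrank ℝ E + 1) * μE (f '' A) := by
  have hfx : ContDiffAt ℝ 1 f x := hf.contDiffAt (hW.mem_nhds hx)
  set L := fderiv ℝ f x with hL
  let J : E → ℝ≥0∞ := fun y => ENNReal.ofReal (fderiv ℝ f y : E →ₗ[ℝ] F).normDet
  obtain ⟨s, hs, hsd⟩ := eventually_edist_le_of_hasStrictFDerivAt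
    (hfx.hasStrictFDerivAt (by simp)) (hinj x hx) hK
  have hJpos : 0 < (L : E →ₗ[ℝ] F).normDet := by
    refine lt_of_le_of_ne (LinearMap.normDet_nonneg _) fun h => ?_
    exact LinearMap.normDet_eq_zero_iff_ker_ne_bot.1 h.symm (LinearMap.ker_eq_bot.2 (hinj x hx))
  have hJc : ContinuousAt (fun y => (fderiv ℝ f y : E →ₗ[ℝ] F).normDet) x :=
    continuous_normDet.continuousAt.comp
      (hfx.fderiv_right (m := 0) (by norm_num)).continuousAt
  have hKr : (1 : ℝ) < K := by exact_mod_cast hK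
  have hK0 : (0 : ℝ) < K := by linarith
  have ev1 : ∀ᶠ y in 𝓝 x, (fderiv ℝ f y : E →ₗ[ℝ] F).normDet
      < K * (L : E →ₗ[ℝ] F).normDet := hJc.eventually_lt_const (by nlinarith)
  have ev2 : ∀ᶠ y in 𝓝 x, (L : E →ₗ[ℝ] F).normDet / K
      < (fderiv ℝ f y : E →ₗ[ℝ] F).normDet :=
    hJc.eventually_const_lt (by rw [div_lt_iff₀ hK0]; nlinarith)
  refine ⟨s ∩ {y | _ ∧ _}, Filter.inter_mem hs (ev1.and ev2), fun A hA hAs => ?_⟩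
  have hJ1 : ∀ y ∈ A, J y ≤ K * J x := by
    intro y hy
    have h := (hAs hy).2.1.le
    have h2 := ENNReal.ofReal_le_ofReal h
    rwa [ENNReal.ofReal_mul hK0.le, ENNReal.ofReal_coe_nnreal] at h2
  have hJ2 : ∀ y ∈ A, J x ≤ K * J y := by
    intro y hy
    have h := (hAs hy).2.2.le
    rw [div_le_iff₀' hK0] at h
    have h2 := ENNReal.ofReal_le_ofReal h
    rwa [ENNReal.ofReal_mul hK0.le, ENNReal.ofReal_coe_nnreal] at h2
  have himg : μE (L '' A) = J x * volume A :=
    LinearMap.euclideanHausdorffMeasure_image_eq_normDet_mul_volume (L : E →ₗ[ℝ] F) A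
  have hfL : μE (f '' A) ≤ (K : ℝ≥0∞) ^ Module.finrank ℝ E * μE (L '' A) :=
    euclideanHausdorffMeasure_image_le _ fun y hy z hz => (hsd y (hAs hy).1 z (hAs hz).1).1
  have hLf : μE (L '' A) ≤ (K : ℝ≥0∞) ^ Module.finrank ℝ E * μE (f '' A) :=
    euclideanHausdorffMeasure_image_le _ fun y hy z hz => (hsd y (hAs hy).1 z (hAs hz).1).2
  have hI1 : J x * volume A ≤ K * ∫⁻ y in A, J y := by
    rw [← lintegral_const_mul' _ _ ENNReal.coe_ne_top, ← setLIntegral_const]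
    exact setLIntegral_mono' hA hJ2
  have hI2 : ∫⁻ y in A, J y ≤ K * (J x * volume A) := by
    rw [← mul_assoc, ← setLIntegral_const]
    exact setLIntegral_mono' hA hJ1
  constructor
  · calc _ ≤ _ := hfL
      _ ≤ (K : ℝ≥0∞) ^ Module.finrank ℝ E * (K * ∫⁻ y in A, J y) := by
        rw [himg]; gcongr
      _ = _ := by rw [pow_succ, mul_assoc]
  · calc _ ≤ _ := hI2
      _ ≤ K * ((K : ℝ≥0∞) ^ Module.finrank ℝ E * μE (f '' A)) := by
        rw [← himg]; gcongr
      _ = _ := by rw [pow_succ', mul_assoc]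

/-- The area formula for injective immersions. -/
theorem euclideanHausdorffMeasure_image_eq_lintegral {f : E → F} {W : Set E} (hW : IsOpen W)
    (hf : ContDiffOn ℝ 1 f W) (hinj : ∀ x ∈ W, Function.Injective (fderiv ℝ f x))
    (hfinj : Set.InjOn f W) {A : Set E} (hA : MeasurableSet A) (hAW : A ⊆ W) :
    μE (f '' A) = ∫⁻ y in A, ENNReal.ofReal (fderiv ℝ f y : E →ₗ[ℝ] F).normDet := by
  have : CompleteSpace E := FiniteDimensional.complete ℝ E
  have : ProperSpace E := FiniteDimensional.proper_real E
  let J : E → ℝ≥0∞ := fun y => ENNReal.ofReal (fderiv ℝ f y : E →ₗ[ℝ] F).normDet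
  have key : ∀ K : ℝ≥0, 1 < K →
      μE (f '' A) ≤ (K : ℝ≥0∞) ^ (Module.finrank ℝ E + 1) * ∫⁻ y in A, J y ∧
      ∫⁻ y in A, J y ≤ (K : ℝ≥0∞) ^ (Module.finrank ℝ E + 1) * μE (f '' A) := by
    intro K hK
    have hloc : ∀ x ∈ W, ∃ s, IsOpen s ∧ x ∈ s ∧ ∀ A, MeasurableSet A → A ⊆ s →
        μE (f '' A) ≤ (K : ℝ≥0∞) ^ (Module.finrank ℝ E + 1) * ∫⁻ y in A, J y ∧
        ∫⁻ y in A, J y ≤ (K : ℝ≥0∞) ^ (Module.finrank ℝ E + 1) * μE (f '' A) := by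
      intro x hx
      obtain ⟨s, hs, h⟩ := exists_nhds_area_le hW hf hinj hK hx
      exact ⟨interior s, isOpen_interior, mem_interior_iff_mem_nhds.2 hs,
        fun A hA hAs => h A hA (hAs.trans interior_subset)⟩
    choose! s hso hxs hsA using hloc
    obtain ⟨t, htW, htc, hcov⟩ := TopologicalSpace.countable_cover_nhdsWithin
      (f := s) (s := W) fun x hx => mem_nhdsWithin_of_mem_nhds ((hso x hx).mem_nhds (hxs x hx))
    -- split `A` along the countable cover; the comparison holds on each piece
    rcases t.eq_empty_or_nonempty with rfl | htne
    · have : A = ∅ := by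
        rw [Set.biUnion_empty] at hcov
        exact Set.subset_empty_iff.1 (hAW.trans hcov)
      simp [this]
    obtain ⟨q, rfl⟩ := htc.exists_eq_range htne
    have hq : ∀ i, q i ∈ W := fun i => htW (Set.mem_range_self i)
    rw [Set.biUnion_range] at hcov
    let D : ℕ → Set E := disjointed fun i => s (q i)
    have hDm : ∀ i, MeasurableSet (A ∩ D i) := fun i =>
      hA.inter (.disjointed (fun j => (hso _ (hq j)).measurableSet) i)
    have hDs : ∀ i, A ∩ D i ⊆ s (q i) := fun i =>
      Set.inter_subset_right.trans (disjointed_subset _ i)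
    have hAD : A = ⋃ i, A ∩ D i := by
      rw [← Set.inter_iUnion, iUnion_disjointed, Set.inter_eq_left.2 (hAW.trans hcov)]
    have hdisj : Pairwise (Function.onFun Disjoint fun i => A ∩ D i) := fun i j hij =>
      (disjoint_disjointed (fun i => s (q i)) hij).mono Set.inter_subset_right
        Set.inter_subset_right
    have h1 : ∫⁻ y in A, J y = ∑' i, ∫⁻ y in A ∩ D i, J y := by
      conv_lhs => rw [hAD]
      exact lintegral_iUnion hDm hdisj J
    have h2 : μE (f '' A) = ∑' i, μE (f '' (A ∩ D i)) := by
      conv_lhs => rw [hAD, Set.image_iUnion]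
      refine measure_iUnion (fun i j hij => ?_) fun i => ?_
      · exact (hdisj hij).image hfinj (Set.inter_subset_left.trans hAW)
          (Set.inter_subset_left.trans hAW)
      · exact (hDm i).image_of_continuousOn_injOn
          (hf.continuousOn.mono (Set.inter_subset_left.trans hAW))
          (hfinj.mono (Set.inter_subset_left.trans hAW))
    rw [h1, h2, ← ENNReal.tsum_mul_left, ← ENNReal.tsum_mul_left]
    exact ⟨ENNReal.tsum_le_tsum fun i => (hsA _ (hq i) _ (hDm i) (hDs i)).1,
      ENNReal.tsum_le_tsum fun i => (hsA _ (hq i) _ (hDm i) (hDs i)).2⟩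
  have lim : ∀ b : ℝ≥0∞, Filter.Tendsto
      (fun K : ℝ≥0 => (K : ℝ≥0∞) ^ (Module.finrank ℝ E + 1) * b) (𝓝[>] 1) (𝓝 b) := by
    intro b
    have h1 : Filter.Tendsto (fun K : ℝ≥0 => (K : ℝ≥0∞) ^ (Module.finrank ℝ E + 1)) (𝓝[>] 1)
        (𝓝 1) := by
      have h2 : Filter.Tendsto (fun K : ℝ≥0 => K ^ (Module.finrank ℝ E + 1)) (𝓝[>] 1)
          (𝓝 (1 ^ (Module.finrank ℝ E + 1))) :=
        ((continuous_pow _).tendsto _).mono_left nhdsWithin_le_nhds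
      rw [one_pow] at h2
      simpa only [ENNReal.coe_pow, ENNReal.coe_one] using ENNReal.tendsto_coe.2 h2
    simpa using ENNReal.Tendsto.mul_const (b := b) h1 (Or.inl one_ne_zero)
  apply le_antisymm
  · exact ge_of_tendsto (lim _) (eventually_nhdsWithin_of_forall fun K hK => (key K hK).1)
  · exact ge_of_tendsto (lim _) (eventually_nhdsWithin_of_forall fun K hK => (key K hK).2)

end AreaFormula

/-! ### Area in a graph chart -/

lemma IsSmoothHypersurface.measurableSet (hS : IsSmoothHypersurface S) : MeasurableSet S := by
  have h : IsLocallyClosed S := by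
    refine ((isLocallyClosed_tfae S).out 0 2).2 fun p hp => ?_
    obtain ⟨τ, U, -, -, hU, hpU, hτ, hSU, -⟩ := hS.exists_slice hp
    refine ⟨U, hU.mem_nhds hpU, ?_⟩
    have hc : Continuous (U.domRestrict τ) :=
      continuousOn_iff_continuous_domRestrict.1 hτ.continuousOn
    convert isClosed_singleton (x := (0 : ℝ)) |>.preimage hc using 1
    ext z
    exact hSU z z.2
  obtain ⟨U, Z, hU, hZ, rfl⟩ := h
  exact hU.measurableSet.inter hZ.measurableSet

namespace GraphChart

variable (c : GraphChart S ν) {x : EuclideanSpace ℝ (Fin n)}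

/-- The Jacobian of a graph is the reciprocal of the last component of the unit normal. -/
lemma normDet_fderiv_G (hν : IsUnitNormal S ν) (hx : x ∈ c.W) :
    (fderiv ℝ c.G x : EuclideanSpace ℝ (Fin n) →ₗ[ℝ] Amb n).normDet
      = (inner ℝ (ν (c.G x)) c.e)⁻¹ := by
  set N := ν (c.G x) with hN
  set L : EuclideanSpace ℝ (Fin n) →ₗ[ℝ] Amb n := (fderiv ℝ c.G x).toLinearMap with hL
  set k := inner ℝ N c.e with hk
  have hkpos : 0 < k := c.inner_pos x hx
  let b := EuclideanSpace.basisFun (Fin n) ℝ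
  let a : Fin n → ℝ := fun i => inner ℝ c.e (L (b i))
  have hLb : ∀ i, L (b i) = c.ι (b i) + a i • c.e := by
    intro i
    have h1 := c.ι_π (L (b i))
    rw [hL, ContinuousLinearMap.coe_coe, c.π_fderiv_G hx] at h1
    rw [h1]
    simp [a, hL]
  have he2 : inner ℝ c.e c.e = (1 : ℝ) := by
    rw [real_inner_self_eq_norm_sq, c.norm_e]; norm_num
  have hei : ∀ w, inner ℝ c.e (c.ι w) = 0 := fun w => by rw [real_inner_comm, c.inner_e]
  have hNb : ∀ i, inner ℝ (b i) (c.π N) = - (k * a i) := by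
    intro i
    have h1 : inner ℝ N (L (b i)) = 0 := c.inner_normal_fderiv_G hν hx _
    rw [hLb, inner_add_right, inner_smul_right, ← c.inner_π, real_inner_comm] at h1
    rw [← hk] at h1
    linarith
  have hnorm : k ^ 2 * ∑ i, a i ^ 2 + k ^ 2 = 1 := by
    have h1 : N = c.ι (c.π N) + k • c.e := by rw [c.ι_π, real_inner_comm, ← hk]; simp
    have h2 : inner ℝ N N = (1 : ℝ) := by
      rw [real_inner_self_eq_norm_sq, hν.norm_eq_one _ (c.G_mem x hx)]; norm_num
    rw [h1, inner_add_left, inner_add_right, inner_add_right, c.ι.inner_map_map, inner_smul_left,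
      inner_smul_left, inner_smul_right, inner_smul_right, hei, c.inner_e, he2,
      ← b.sum_inner_mul_inner (c.π N) (c.π N)] at h2
    have h3 : ∑ i, inner ℝ (c.π N) (b i) * inner ℝ (b i) (c.π N) = k ^ 2 * ∑ i, a i ^ 2 := by
      rw [Finset.mul_sum]
      refine Finset.sum_congr rfl fun i _ => ?_
      rw [real_inner_comm, hNb]
      ring
    rw [h3] at h2
    simp at h2
    linarith
  have hgram : L.normDet ^ 2 = 1 + ∑ i, a i ^ 2 := by
    have h1 := LinearMap.normDet_sq_eq_det_gram L b
    have h2 : Matrix.gram ℝ (fun i => L (b i))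
        = 1 + Matrix.replicateCol Unit a * Matrix.replicateRow Unit a := by
      ext i j
      simp only [Matrix.gram_apply, hLb, inner_add_left, inner_add_right, inner_smul_left,
        inner_smul_right, hei, c.inner_e, he2, c.ι.inner_map_map, b.inner_eq_ite, Matrix.add_apply,
        Matrix.one_apply, Matrix.mul_apply]
      simp [mul_comm]
    rw [h2, Matrix.det_one_add_replicateCol_mul_replicateRow] at h1
    simpa [dotProduct, sq] using h1
  have hsq : L.normDet ^ 2 = (k⁻¹) ^ 2 := by
    rw [hgram, inv_pow]
    refine eq_inv_of_mul_eq_one_left ?_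
    linarith
  exact (sq_eq_sq₀ (LinearMap.normDet_nonneg _) (by positivity)).1 hsq

lemma injOn_G : Set.InjOn c.G c.W := fun x hx y hy h => by
  rw [← c.π_G x hx, ← c.π_G y hy, h]

lemma G_image : c.G '' c.W = S ∩ c.V := by
  ext z
  constructor
  · rintro ⟨x, hx, rfl⟩
    exact ⟨c.G_mem x hx, c.G_mem_V x hx⟩
  · exact fun hz => ⟨c.π z, c.π_mem z hz, c.G_π z hz⟩

lemma continuousOn_inv_inner (hν : IsUnitNormal S ν) :
    ContinuousOn (fun x => (inner ℝ (ν (c.G x)) c.e)⁻¹) c.W :=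
  ((hν.smooth.continuousOn.comp c.contDiffOn_G.continuousOn c.G_mem).inner
    continuousOn_const).inv₀ fun x hx => (c.inner_pos x hx).ne'

lemma area_image (hν : IsUnitNormal S ν) {A : Set (EuclideanSpace ℝ (Fin n))}
    (hA : MeasurableSet A) (hAW : A ⊆ c.W) :
    Measure.euclideanHausdorffMeasure n (c.G '' A)
      = ∫⁻ x in A, ENNReal.ofReal (inner ℝ (ν (c.G x)) c.e)⁻¹ := by
  have h := euclideanHausdorffMeasure_image_eq_lintegral c.isOpen_W
    (c.contDiffOn_G.of_le (by norm_num)) (fun x hx => ?_) c.injOn_G hA hAW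
  · rw [finrank_euclideanSpace_fin] at h
    rw [h]
    exact setLIntegral_congr_fun hA fun x hx => by
      simp only [c.normDet_fderiv_G hν (hAW hx)]
  · exact Function.LeftInverse.injective (c.π_fderiv_G hx)

/-- The area formula in a graph chart: the area measure is the image of `⟨ν, e⟩⁻¹ dx`. -/
lemma restrict_area (hν : IsUnitNormal S ν) :
    (Measure.euclideanHausdorffMeasure n).restrict (S ∩ c.V)
      = Measure.map c.G ((volume.restrict c.W).withDensity
          fun x => ENNReal.ofReal (inner ℝ (ν (c.G x)) c.e)⁻¹) := by
  have hG : AEMeasurable c.G ((volume.restrict c.W).withDensity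
      fun x => ENNReal.ofReal (inner ℝ (ν (c.G x)) c.e)⁻¹) :=
    (c.contDiffOn_G.continuousOn.aemeasurable c.isOpen_W.measurableSet).mono_ac
      (withDensity_absolutelyContinuous _ _)
  ext B hB
  have hBW : MeasurableSet (c.W ∩ c.G ⁻¹' B) := by
    have h1 :=
      (continuousOn_iff_continuous_domRestrict.1 c.contDiffOn_G.continuousOn).measurable hB
    convert c.isOpen_W.measurableSet.subtype_image h1 using 1
    ext x
    simp [and_comm]
  rw [Measure.map_apply_of_aemeasurable hG hB, Measure.restrict_apply hB,
    withDensity_apply' _ _, Measure.restrict_restrict₀' c.isOpen_W.measurableSet.nullMeasurableSet,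
    Set.inter_comm _ c.W, ← c.area_image hν hBW Set.inter_subset_left, Set.image_inter_preimage,
    c.G_image, Set.inter_comm B]

lemma setIntegral_area (hS : IsSmoothHypersurface S) (hν : IsUnitNormal S ν) {h : Amb n → ℝ}
    (hh : ContinuousOn h S) :
    ∫ z in S ∩ c.V, h z ∂(Measure.euclideanHausdorffMeasure n)
      = ∫ x in c.W, (inner ℝ (ν (c.G x)) c.e)⁻¹ * h (c.G x) := by
  have hG : AEMeasurable c.G ((volume.restrict c.W).withDensity
      fun x => ENNReal.ofReal (inner ℝ (ν (c.G x)) c.e)⁻¹) :=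
    (c.contDiffOn_G.continuousOn.aemeasurable c.isOpen_W.measurableSet).mono_ac
      (withDensity_absolutelyContinuous _ _)
  have hm : MeasurableSet (S ∩ c.V) := hS.measurableSet.inter c.isOpen_V.measurableSet
  have hh' := (hh.mono Set.inter_subset_left).aestronglyMeasurable (μ :=
    Measure.euclideanHausdorffMeasure n) hm
  rw [c.restrict_area hν] at hh' ⊢
  rw [integral_map hG hh', integral_withDensity_eq_integral_toReal_smul₀]
  · refine setIntegral_congr_fun c.isOpen_W.measurableSet fun x hx => ?_
    simp only [smul_eq_mul]
    rw [ENNReal.toReal_ofReal (inv_pos.2 (c.inner_pos x hx)).le]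
  · exact ((c.continuousOn_inv_inner hν).aemeasurable c.isOpen_W.measurableSet).ennreal_ofReal
  · simp

/-- The divergence in a graph chart: up to the Jacobian `⟨ν, e⟩⁻¹`, the divergence
of a tangential field `X` is the divergence of the vector field `⟨ν, e⟩⁻¹ π X` of the parameter
space. -/
lemma trace_fderiv_eq (hS : IsSmoothHypersurface S) (hν : IsUnitNormal S ν) (hx : x ∈ c.W)
    {X : Amb n → Amb n} (hX : ContDiffOn ℝ 1 X S) (hXt : ∀ p ∈ S, inner ℝ (ν p) (X p) = 0) :
    LinearMap.trace ℝ (EuclideanSpace ℝ (Fin n))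
      (fderiv ℝ (fun y => (inner ℝ (ν (c.G y)) c.e)⁻¹ • c.π (X (c.G y))) x : _ →L[ℝ] _)
      = (inner ℝ (ν (c.G x)) c.e)⁻¹ * surfDiv S X (c.G x) := by
  have hq := c.G_mem x hx
  set q := c.G x with hqdef
  set k := inner ℝ (ν q) c.e with hk
  have hkpos : 0 < k := c.inner_pos x hx
  have hXd := c.hasFDerivAt_fderiv_comp hX hx
  set L := fderiv ℝ (X ∘ c.G) x
  have hνd : HasFDerivWithinAt ν (fderivWithin ℝ ν S q) S q :=
    ((hν.smooth q hq).differentiableWithinAt (by simp)).hasFDerivWithinAt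
  have hνG := c.hasFDerivAt_comp hx hνd
  set M := (fderivWithin ℝ ν S q).comp (fderiv ℝ c.G x) with hM
  have hkd : HasFDerivAt (fun y => inner ℝ (ν (c.G y)) c.e) ((innerSL ℝ c.e).comp M) x := by
    have h1 := hνG.inner ℝ (hasFDerivAt_const c.e x)
    refine h1.congr_fderiv ?_
    ext a
    simp [fderivInnerCLM_apply, real_inner_comm]
  have hkinv := (hasDerivAt_inv hkpos.ne').comp_hasFDerivAt x hkd
  have hZ := hkinv.smul (c.π.hasFDerivAt.comp x hXd)
  have hZ' : fderiv ℝ (fun y => (inner ℝ (ν (c.G y)) c.e)⁻¹ • c.π (X (c.G y))) x = _ := hZ.fderiv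
  rw [hZ', surfDiv_eq hS hν hq (c.hasFDerivWithinAt_of_comp hx hXd)]
  have htr1 : LinearMap.trace ℝ (Amb n) (L.comp c.π : Amb n →L[ℝ] Amb n)
      = LinearMap.trace ℝ (EuclideanSpace ℝ (Fin n)) (c.π.comp L : _ →L[ℝ] _) :=
    LinearMap.trace_comp_comm' c.π.toLinearMap L.toLinearMap
  -- differentiate `⟨ν, X⟩ = 0`
  have hort : ∀ a, inner ℝ (ν q) (L a) = - inner ℝ (M a) (X q) := by
    intro a
    have h1 := hνG.inner ℝ hXd
    have h2 : HasFDerivAt (fun y => inner ℝ ((ν ∘ c.G) y) ((X ∘ c.G) y)) (0 : _ →L[ℝ] ℝ) x :=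
      (hasFDerivAt_const (0 : ℝ) x).congr_of_eventuallyEq
        (Filter.eventuallyEq_of_mem (c.isOpen_W.mem_nhds hx) fun y hy => hXt _ (c.G_mem y hy))
    have h3 := congrArg (fun L : _ →L[ℝ] ℝ => L a) (h1.unique h2)
    simp [fderivInnerCLM_apply] at h3
    rw [← hqdef] at h3
    linarith
  have hMπ : ∀ t, inner ℝ (ν q) t = 0 → M (c.π t) = tangentDeriv S ν q t := by
    intro t ht
    rw [hM, ContinuousLinearMap.comp_apply, c.fderiv_G_π hν hx ht, tangentDeriv,
      ContinuousLinearMap.comp_apply, tangentProj_of_tangent hS hν hq ht]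
  -- the tangent vector with projection `π ν`
  let t := ν q - k⁻¹ • c.e
  have ht : inner ℝ (ν q) t = 0 := by
    simp only [t]
    rw [inner_sub_right, inner_smul_right, real_inner_self_eq_norm_sq, hν.norm_eq_one q hq, ← hk,
      inv_mul_cancel₀ hkpos.ne']
    norm_num
  have hπt : c.π t = c.π (ν q) := by simp [t, c.π_e]
  have hmain : inner ℝ (ν q) (L (c.π (ν q))) = k⁻¹ * inner ℝ c.e (M (c.π (X q))) := by
    rw [hort, ← hπt, hMπ t ht, hMπ (X q) (hXt q hq), shape_symm hS hν hq, inner_sub_left,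
      inner_smul_left, inner_normal_shape hν hq]
    simp
  have htr2 : ∀ (l : EuclideanSpace ℝ (Fin n) →L[ℝ] ℝ) (v : EuclideanSpace ℝ (Fin n)),
      LinearMap.trace ℝ (EuclideanSpace ℝ (Fin n))
        (l.smulRight v : EuclideanSpace ℝ (Fin n) →L[ℝ] EuclideanSpace ℝ (Fin n)) = l v :=
    fun l v => LinearMap.trace_smulRight _ _
  rw [ContinuousLinearMap.toLinearMap_add, map_add, htr2, ContinuousLinearMap.toLinearMap_smul,
    map_smul, htr1, ContinuousLinearMap.comp_apply, hmain]
  simp only [Function.comp_apply, ← hqdef, ← hk, smul_apply, ContinuousLinearMap.comp_apply,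
    innerSL_apply_apply, smul_eq_mul]
  field_simp
  ring

end GraphChart

/-! ### The divergence theorem -/

/-- The divergence of a compactly supported vector field of a Euclidean space integrates to zero. -/
lemma integral_trace_fderiv_eq_zero {E : Type*} [NormedAddCommGroup E] [InnerProductSpace ℝ E]
    [FiniteDimensional ℝ E] [MeasurableSpace E] [BorelSpace E] {Z : E → E} (hZ : ContDiff ℝ 1 Z)
    (hc : HasCompactSupport Z) :
    ∫ x, LinearMap.trace ℝ E (fderiv ℝ Z x : E →L[ℝ] E) = 0 := by
  let b := stdOrthonormalBasis ℝ E
  have hZd : Differentiable ℝ Z := hZ.differentiable (by simp)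
  have h1 : ∀ x, LinearMap.trace ℝ E (fderiv ℝ Z x : E →L[ℝ] E)
      = ∑ i, fderiv ℝ (fun y => inner ℝ (b i) (Z y)) x (b i) := by
    intro x
    rw [LinearMap.trace_eq_sum_inner _ b]
    refine Finset.sum_congr rfl fun i _ => ?_
    rw [fderiv_inner_apply ℝ (differentiableAt_const _) (hZd x)]
    simp
  have hg : ∀ i, ContDiff ℝ 1 fun y => inner ℝ (b i) (Z y) := fun i => contDiff_const.inner ℝ hZ
  have hgc : ∀ i, HasCompactSupport fun y => inner ℝ (b i) (Z y) := fun i =>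
    hc.comp_left (g := fun z => inner ℝ (b i) z) (inner_zero_right _)
  have hint : ∀ i, Integrable fun x => fderiv ℝ (fun y => inner ℝ (b i) (Z y)) x (b i) := fun i =>
    (((hg i).continuous_fderiv (by simp)).clm_apply continuous_const).integrable_of_hasCompactSupport
      ((hgc i).fderiv_apply (𝕜 := ℝ) (b i))
  simp_rw [h1]
  rw [integral_finsetSum _ fun i _ => hint i]
  refine Finset.sum_eq_zero fun i _ => ?_
  have h2 := integral_mul_fderiv_eq_neg_fderiv_mul_of_integrable (𝕜 := ℝ) (μ := volume)
    (f := fun _ : E => (1 : ℝ)) (g := fun y => inner ℝ (b i) (Z y)) (v := b i) (by simp)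
    (by simpa using hint i)
    (by simpa using ((hg i).continuous.integrable_of_hasCompactSupport (hgc i)))
    (fun _ _ => differentiableAt_const _) (fun x _ => (hg i).differentiable (by simp) x)
  simpa using h2

lemma tangentDeriv_eq_zero_of_notMem {F : Type*} [NormedAddCommGroup F] [NormedSpace ℝ F]
    {f : Amb n → F} {K : Set (Amb n)} (hK : IsClosed K) (h0 : ∀ p ∈ S, p ∉ K → f p = 0)
    (hp : p ∈ S) (hpK : p ∉ K) : tangentDeriv S f p = 0 := by
  have h : HasFDerivWithinAt f (0 : Amb n →L[ℝ] F) S p := by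
    refine (hasFDerivWithinAt_const (0 : F) p S).congr_of_eventuallyEq ?_ (h0 p hp hpK)
    filter_upwards [self_mem_nhdsWithin,
      mem_nhdsWithin_of_mem_nhds (hK.isOpen_compl.mem_nhds hpK)] with z hz hzK
    exact h0 z hz hzK
  rw [tangentDeriv_eq h, ContinuousLinearMap.zero_comp]

lemma surfDiv_eq_zero_of_notMem {X : Amb n → Amb n} {K : Set (Amb n)} (hK : IsClosed K)
    (h0 : ∀ p ∈ S, p ∉ K → X p = 0) (hp : p ∈ S) (hpK : p ∉ K) : surfDiv S X p = 0 := by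
  simp [surfDiv, tangentDeriv_eq_zero_of_notMem hK h0 hp hpK]

section Area

variable (hS : IsSmoothHypersurface S) (hν : IsUnitNormal S ν)
include hS hν

/-- Compact subsets of a hypersurface have finite area. -/
lemma euclideanHausdorffMeasure_lt_top {K : Set (Amb n)} (hK : IsCompact K) (hKS : K ⊆ S) :
    Measure.euclideanHausdorffMeasure n K < ⊤ := by
  refine hK.measure_lt_top_of_nhdsWithin fun p hp => ?_
  obtain ⟨c, hpc⟩ := exists_graphChart hS hν (hKS hp)
  have hx := c.π_mem p ⟨hKS hp, hpc⟩
  obtain ⟨B, hB, hBW, hBc⟩ := local_compact_nhds (c.isOpen_W.mem_nhds hx)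
  refine ⟨c.G '' B, ?_, ?_⟩
  · filter_upwards [self_mem_nhdsWithin, mem_nhdsWithin_of_mem_nhds (c.isOpen_V.mem_nhds hpc),
      mem_nhdsWithin_of_mem_nhds (c.π.continuous.continuousAt.preimage_mem_nhds hB)]
      with z hz hzV hzB
    exact ⟨c.π z, hzB, c.G_π z ⟨hKS hz, hzV⟩⟩
  · rw [c.area_image hν hBc.measurableSet hBW]
    exact (((c.continuousOn_inv_inner hν).mono hBW).integrableOn_compact hBc).lintegral_lt_top

/-- Continuous functions with compact support on a hypersurface are integrable. -/
lemma integrable_area {h : Amb n → ℝ} (hh : ContinuousOn h S) {K : Set (Amb n)}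
    (hK : IsCompact K) (hKS : K ⊆ S) (h0 : ∀ p ∈ S, p ∉ K → h p = 0) :
    Integrable h (area S) := by
  have h1 : IntegrableOn h K (Measure.euclideanHausdorffMeasure n) :=
    (hh.mono hKS).integrableOn_of_subset_isCompact hK hK.measurableSet Set.Subset.rfl
      (euclideanHausdorffMeasure_lt_top hS hν hK hKS).ne
  exact h1.of_forall_sdiff_eq_zero hS.measurableSet fun p hp => h0 p hp.1 hp.2

lemma continuousOn_surfDiv {X : Amb n → Amb n} (hX : ContDiffOn ℝ 1 X S) :
    ContinuousOn (surfDiv S X) S := by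
  have h1 : ∀ p ∈ S, surfDiv S X p = ∑ i : Fin (n + 1),
      (inner ℝ (EuclideanSpace.basisFun (Fin (n + 1)) ℝ i)
        (tangentDeriv S X p (EuclideanSpace.basisFun (Fin (n + 1)) ℝ i))
      - inner ℝ (ν p) (tangentDeriv S X p (EuclideanSpace.basisFun (Fin (n + 1)) ℝ i))
        * inner ℝ (EuclideanSpace.basisFun (Fin (n + 1)) ℝ i) (ν p)) := by
    intro p hp
    rw [surfDiv, LinearMap.trace_eq_sum_inner _ (EuclideanSpace.basisFun (Fin (n + 1)) ℝ)]
    refine Finset.sum_congr rfl fun i _ => ?_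
    rw [ContinuousLinearMap.coe_coe, ContinuousLinearMap.comp_apply, hν.tangentProj_apply hS hp,
      inner_sub_right, inner_smul_right]
  refine ContinuousOn.congr (continuousOn_finsetSum _ fun i _ => ?_) h1
  have h2 : ContinuousOn (fun p => tangentDeriv S X p (EuclideanSpace.basisFun (Fin (n + 1)) ℝ i))
      S := (contDiffOn_tangentDeriv hS hν (k := 0) (by norm_num) (by simpa using hX) _).continuousOn
  have h3 := hν.smooth.continuousOn
  exact (continuousOn_const.inner h2).sub ((h3.inner h2).mul (continuousOn_const.inner h3))

/-- The divergence theorem for vector fields supported in a graph chart. -/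
lemma integral_surfDiv_eq_zero_of_graphChart (c : GraphChart S ν) {X : Amb n → Amb n}
    (hX : ContDiffOn ℝ 1 X S) (hXt : ∀ p ∈ S, inner ℝ (ν p) (X p) = 0) {K : Set (Amb n)}
    (hK : IsCompact K) (hKS : K ⊆ S ∩ c.V) (h0 : ∀ p ∈ S, p ∉ K → X p = 0) :
    ∫ p, surfDiv S X p ∂(area S) = 0 := by
  let Z₀ : EuclideanSpace ℝ (Fin n) → EuclideanSpace ℝ (Fin n) :=
    fun y => (inner ℝ (ν (c.G y)) c.e)⁻¹ • c.π (X (c.G y))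
  let Z := c.W.indicator Z₀
  have hKc : IsCompact (c.π '' K) := hK.image c.π.continuous
  have hKW : c.π '' K ⊆ c.W := by
    rintro _ ⟨z, hz, rfl⟩
    exact c.π_mem z (hKS hz)
  have hZ0 : ∀ x, x ∉ c.π '' K → Z x = 0 := by
    intro x hx
    by_cases hxW : x ∈ c.W
    · have : c.G x ∉ K := fun h => hx ⟨_, h, c.π_G x hxW⟩
      simp [Z, Z₀, h0 _ (c.G_mem x hxW) this]
    · exact Set.indicator_of_notMem hxW _
  have hZev : ∀ x ∈ c.W, Z =ᶠ[𝓝 x] Z₀ := fun x hx =>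
    Filter.eventuallyEq_of_mem (c.isOpen_W.mem_nhds hx) fun y hy => Set.indicator_of_mem hy _
  have hZev0 : ∀ x, x ∉ c.π '' K → Z =ᶠ[𝓝 x] fun _ => 0 := fun x hx =>
    Filter.eventuallyEq_of_mem (hKc.isClosed.isOpen_compl.mem_nhds hx) fun y hy => hZ0 y hy
  have hZ₀ : ContDiffOn ℝ 1 Z₀ c.W :=
    (((c.contDiffOn_comp (by norm_num) (contDiffOn_infty.1 hν.smooth 1)).inner ℝ
      contDiffOn_const).inv fun x hx => (c.inner_pos x hx).ne').smul
      (c.π.contDiff.comp_contDiffOn (c.contDiffOn_comp (by norm_num) hX))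
  have hZc : ContDiff ℝ 1 Z := by
    rw [contDiff_iff_contDiffAt]
    intro x
    by_cases hx : x ∈ c.W
    · exact (hZ₀.contDiffAt (c.isOpen_W.mem_nhds hx)).congr_of_eventuallyEq (hZev x hx)
    · exact contDiffAt_const.congr_of_eventuallyEq (hZev0 x fun h => hx (hKW h))
  have hint := integral_trace_fderiv_eq_zero hZc (HasCompactSupport.intro hKc hZ0)
  have hdiv0 : ∀ p ∈ S, p ∉ K → surfDiv S X p = 0 := fun p hp hpK =>
    surfDiv_eq_zero_of_notMem hK.isClosed h0 hp hpK
  have h1 : ∫ p in S ∩ c.V, surfDiv S X p ∂(Measure.euclideanHausdorffMeasure n)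
      = ∫ p, surfDiv S X p ∂(area S) :=
    (setIntegral_eq_of_subset_of_forall_sdiff_eq_zero hS.measurableSet Set.inter_subset_left
      fun p hp => hdiv0 p hp.1 fun h => hp.2 (hKS h)).symm
  rw [← h1, c.setIntegral_area hS hν (continuousOn_surfDiv hS hν hX), ← hint]
  have h2 : ∀ x, x ∉ c.W → LinearMap.trace ℝ (EuclideanSpace ℝ (Fin n))
      (fderiv ℝ Z x : _ →L[ℝ] EuclideanSpace ℝ (Fin n)) = 0 := by
    intro x hx
    rw [(hZev0 x fun h => hx (hKW h)).fderiv_eq]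
    simp
  rw [← setIntegral_eq_integral_of_forall_compl_eq_zero h2]
  refine setIntegral_congr_fun c.isOpen_W.measurableSet fun x hx => ?_
  rw [(hZev x hx).fderiv_eq]
  exact (c.trace_fderiv_eq hS hν hx hX hXt).symm

/-- The divergence theorem on a hypersurface for compactly supported tangential fields. -/
theorem integral_surfDiv_eq_zero {X : Amb n → Amb n}
    (hX : ContDiffOn ℝ 1 X S) (hXt : ∀ p ∈ S, inner ℝ (ν p) (X p) = 0) {K : Set (Amb n)}
    (hK : IsCompact K) (hKS : K ⊆ S) (h0 : ∀ p ∈ S, p ∉ K → X p = 0) :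
    ∫ p, surfDiv S X p ∂(area S) = 0 := by
  choose c hc using fun p : K => exists_graphChart hS hν (hKS p.2)
  obtain ⟨t, hcov⟩ := hK.elim_nhds_subcover' (fun p hp => (c ⟨p, hp⟩).V)
    fun p hp => (c ⟨p, hp⟩).isOpen_V.mem_nhds (hc ⟨p, hp⟩)
  obtain ⟨χ, hχ⟩ := SmoothPartitionOfUnity.exists_isSubordinate (modelWithCornersSelf ℝ (Amb n))
    hK.isClosed (fun i : t => (c i).V) (fun i => (c i).isOpen_V) (by
      intro x hx
      obtain ⟨i, hi, hxi⟩ := Set.mem_iUnion₂.1 (hcov hx)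
      exact Set.mem_iUnion.2 ⟨⟨i, hi⟩, hxi⟩)
  have hχc : ∀ i, ContDiff ℝ ∞ (χ i) := fun i => (χ i).contMDiff.contDiff
  let Y : t → Amb n → Amb n := fun i p => χ i p • X p
  have hY : ∀ i, ContDiffOn ℝ 1 (Y i) S := fun i =>
    ((hχc i).of_le (by exact_mod_cast le_top)).contDiffOn.smul hX
  have hYX : Set.EqOn X (fun p => ∑ i, Y i p) S := by
    intro p hp
    by_cases hpK : p ∈ K
    · have := χ.sum_eq_one hpK
      rw [finsum_eq_sum_of_fintype] at this
      simp only [Y, ← Finset.sum_smul, this, one_smul]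
    · simp [Y, h0 p hp hpK]
  have hdiv : ∀ p ∈ S, surfDiv S X p = ∑ i, surfDiv S (Y i) p := by
    intro p hp
    have hd : ∀ i, HasFDerivWithinAt (Y i) (fderivWithin ℝ (Y i) S p) S p := fun i =>
      ((hY i p hp).differentiableWithinAt (by simp)).hasFDerivWithinAt
    rw [surfDiv_congr hYX hp, surfDiv_eq hS hν hp (HasFDerivWithinAt.fun_sum fun i _ => hd i)]
    simp_rw [surfDiv_eq hS hν hp (hd _)]
    simp [← traceCLM_apply, map_sum, inner_sum, Finset.sum_sub_distrib]
  have hYK : ∀ i, ∀ p ∈ S, p ∉ K ∩ tsupport (χ i) → Y i p = 0 := by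
    intro i p hp hpK
    by_cases h : p ∈ K
    · have : χ i p = 0 := image_eq_zero_of_notMem_tsupport fun h' => hpK ⟨h, h'⟩
      simp [Y, this]
    · simp [Y, h0 p hp h]
  have hKi : ∀ i, IsCompact (K ∩ tsupport (χ i)) := fun i => hK.inter_right (isClosed_tsupport _)
  have h1 : ∫ p, surfDiv S X p ∂(area S) = ∫ p, ∑ i, surfDiv S (Y i) p ∂(area S) :=
    setIntegral_congr_fun hS.measurableSet hdiv
  rw [h1, integral_finsetSum]
  · refine Finset.sum_eq_zero fun i _ => ?_
    refine integral_surfDiv_eq_zero_of_graphChart hS hν (c i) (hY i) (fun p hp => ?_) (hKi i)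
      (fun p hp => ⟨hKS hp.1, hχ i hp.2⟩) (hYK i)
    simp [Y, inner_smul_right, hXt p hp]
  · intro i _
    exact integrable_area hS hν (continuousOn_surfDiv hS hν (hY i)) (hKi i)
      (fun p hp => hKS hp.1)
      fun p hp hpK => surfDiv_eq_zero_of_notMem (hKi i).isClosed (hYK i) hp hpK

end Area

/-! ### The stability inequality -/

lemma rho_pos (x : Amb n) : 0 < rho x := Real.exp_pos _

lemma contDiff_rho {k : ℕ∞ω} : ContDiff ℝ k (rho : Amb n → ℝ) :=
  Real.contDiff_exp.comp ((contDiff_norm_sq ℝ).neg.div_const 4)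

lemma hasFDerivAt_rho (x : Amb n) :
    HasFDerivAt rho ((-(1 / 2) * rho x) • (innerSL ℝ x : Amb n →L[ℝ] ℝ)) x := by
  have h1 := (((hasStrictFDerivAt_norm_sq x).hasFDerivAt).const_mul (-(1 / 4 : ℝ))).exp
  have h2 : (rho : Amb n → ℝ) = fun x => Real.exp (-(1 / 4) * ‖x‖ ^ 2) := by
    ext x
    unfold rho
    congr 1
    ring
  rw [h2]
  refine h1.congr_fderiv ?_
  ext w
  simp
  ring

lemma continuousOn_normSqA (hS : IsSmoothHypersurface S) (hν : IsUnitNormal S ν) :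
    ContinuousOn (normSqA S ν) S := by
  refine continuousOn_finsetSum _ fun i _ => continuousOn_finsetSum _ fun j _ =>
    ContinuousOn.pow ?_ 2
  refine ContinuousOn.congr ?_ fun p hp => secondFF_eq hS hν hp _ _
  exact (contDiffOn_tangentDeriv hS hν (k := 0) (by norm_num)
    (by simpa using contDiffOn_infty.1 hν.smooth 1) _).continuousOn.inner continuousOn_const

section Inequality

variable {K : Set (Amb n)} {φ : Amb n → ℝ}

lemma integrable_normSqA_mul (hS : IsSmoothHypersurface S) (hν : IsUnitNormal S ν)
    (hφ : ContinuousOn φ S) (hK : IsCompact K) (hKS : K ⊆ S) (h0 : ∀ p ∈ S, p ∉ K → φ p = 0) :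
    Integrable (fun x => normSqA S ν x * φ x ^ 2 * rho x) (area S) :=
  integrable_area hS hν (((continuousOn_normSqA hS hν).mul (hφ.pow 2)).mul
    (contDiff_rho (k := 0)).continuous.continuousOn) hK hKS
    fun p hp hpK => by simp [h0 p hp hpK]

lemma grad_eq_zero_of_notMem (hK : IsClosed K) (h0 : ∀ p ∈ S, p ∉ K → φ p = 0) (hp : p ∈ S)
    (hpK : p ∉ K) : grad S φ p = 0 := by
  simp [grad, tangentDeriv_eq_zero_of_notMem hK h0 hp hpK]

lemma integrable_norm_grad_sq_mul (hS : IsSmoothHypersurface S) (hν : IsUnitNormal S ν)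
    (hφ : ContDiffOn ℝ 1 φ S) (hK : IsCompact K) (hKS : K ⊆ S)
    (h0 : ∀ p ∈ S, p ∉ K → φ p = 0) :
    Integrable (fun x => ‖grad S φ x‖ ^ 2 * rho x) (area S) :=
  integrable_area hS hν
    (((contDiffOn_grad hS hν (k := 0) (by norm_num) (by simpa using hφ)).continuousOn.norm.pow
      2).mul (contDiff_rho (k := 0)).continuous.continuousOn) hK hKS
    fun p hp hpK => by simp [grad_eq_zero_of_notMem hK.isClosed h0 hp hpK]

/-- The stability inequality in gradient form. For `u = ⟨v, ν⟩`, the field `φ² ρ ∇u / u` has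
divergence `ρ (|∇φ|² - |A|² φ² - |∇φ - φ ∇u / u|²)` by the Jacobi equation. -/
theorem integral_normSqA_le (hS : IsSelfShrinker S ν) {v : Amb n}
    (hv : ∀ p ∈ K, 0 < inner ℝ v (ν p)) (hφ : ContDiffOn ℝ 1 φ S) (hK : IsCompact K)
    (hKS : K ⊆ S) (h0 : ∀ p ∈ S, p ∉ K → φ p = 0) :
    ∫ x, normSqA S ν x * φ x ^ 2 * rho x ∂(area S)
      ≤ ∫ x, ‖grad S φ x‖ ^ 2 * rho x ∂(area S) := by
  have hM := hS.hypersurface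
  have hν := hS.unitNormal
  let u : Amb n → ℝ := fun q => inner ℝ v (ν q)
  have hu : ContDiffOn ℝ 2 u S := contDiffOn_const.inner ℝ (contDiffOn_infty.1 hν.smooth 2)
  have hgu : ContDiffOn ℝ 1 (grad S u) S :=
    contDiffOn_grad hM hν (k := 1) (by norm_num) (by norm_num; exact hu)
  -- `u` may vanish off `K`, but there `f` is zero
  let f : Amb n → ℝ := fun q => φ q ^ 2 * rho q * (u q)⁻¹
  have hf : ContDiffOn ℝ 1 f S := by
    intro p hp
    by_cases hpK : p ∈ K
    · exact (((hφ p hp).pow 2).mul contDiff_rho.contDiffAt.contDiffWithinAt).mul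
        (((hu p hp).of_le (by norm_num)).inv (hv p hpK).ne')
    · refine contDiffWithinAt_const (c := (0 : ℝ)).congr_of_eventuallyEq ?_
        (by simp [f, h0 p hp hpK])
      filter_upwards [self_mem_nhdsWithin,
        mem_nhdsWithin_of_mem_nhds (hK.isClosed.isOpen_compl.mem_nhds hpK)] with z hz hzK
      simp [f, h0 z hz hzK]
  let X : Amb n → Amb n := fun q => f q • grad S u q
  have hX : ContDiffOn ℝ 1 X S := hf.smul hgu
  have hX0 : ∀ p ∈ S, p ∉ K → X p = 0 := fun p hp hpK => by simp [X, f, h0 p hp hpK]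
  have hXt : ∀ p ∈ S, inner ℝ (ν p) (X p) = 0 := fun p hp => by
    simp [X, inner_smul_right, inner_normal_grad hM hν hp]
  have hdiv := integral_surfDiv_eq_zero hM hν hX hXt hK hKS hX0
  have hint1 := integrable_normSqA_mul hM hν hφ.continuousOn hK hKS h0
  have hint2 := integrable_norm_grad_sq_mul hM hν hφ hK hKS h0
  rw [← sub_nonneg, ← integral_sub hint2 hint1, ← hdiv]
  refine setIntegral_mono_on ?_ (hint2.sub hint1) hM.measurableSet fun p hp => ?_
  · exact integrable_area hM hν (continuousOn_surfDiv hM hν hX) hK hKS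
      fun p hp hpK => surfDiv_eq_zero_of_notMem hK.isClosed hX0 hp hpK
  by_cases hpK : p ∈ K
  swap
  · rw [surfDiv_eq_zero_of_notMem hK.isClosed hX0 hp hpK,
      grad_eq_zero_of_notMem hK.isClosed h0 hp hpK, h0 p hp hpK]
    simp
  have hup : u p ≠ 0 := (hv p hpK).ne'
  have hφd := ((hφ p hp).differentiableWithinAt (by simp)).hasFDerivWithinAt
  have hud := ((hu p hp).differentiableWithinAt (by simp)).hasFDerivWithinAt
  have hfd : HasFDerivWithinAt f _ S p :=
    ((hφd.pow 2).mul (hasFDerivAt_rho p).hasFDerivWithinAt).mul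
      ((hasDerivAt_inv hup).comp_hasFDerivWithinAt p hud)
  have hgt := inner_normal_grad hM hν hp u
  have hgf : inner ℝ (grad S f p) (grad S u p)
      = 2 * φ p * rho p * (u p)⁻¹ * inner ℝ (grad S φ p) (grad S u p)
        - (1 / 2) * φ p ^ 2 * rho p * (u p)⁻¹ * inner ℝ p (grad S u p)
        - φ p ^ 2 * rho p * ((u p) ^ 2)⁻¹ * ‖grad S u p‖ ^ 2 := by
    rw [← real_inner_self_eq_norm_sq (grad S u p)]
    rw [inner_grad S f, inner_grad S φ, inner_grad S u, tangentDeriv_eq hfd,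
      tangentDeriv_eq hφd, tangentDeriv_eq hud]
    simp only [ContinuousLinearMap.comp_apply, tangentProj_of_tangent hM hν hp hgt]
    simp
    ring
  have hJ : laplacian S u p = (1 / 2) * inner ℝ p (grad S u p) - normSqA S ν p * u p :=
    laplacian_inner_normal hS hp v
  have hXp : surfDiv S X p = f p * laplacian S u p + inner ℝ (grad S f p) (grad S u p) :=
    surfDiv_smul hM hν hp hfd.differentiableWithinAt
      ((hgu p hp).differentiableWithinAt (by simp)) hgt
  have hsq : ‖grad S φ p - (φ p * (u p)⁻¹) • grad S u p‖ ^ 2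
      = ‖grad S φ p‖ ^ 2 - 2 * (φ p * (u p)⁻¹) * inner ℝ (grad S φ p) (grad S u p)
        + (φ p * (u p)⁻¹) ^ 2 * ‖grad S u p‖ ^ 2 := by
    rw [norm_sub_sq_real, norm_smul, inner_smul_right, mul_pow, Real.norm_eq_abs, sq_abs]
    ring
  have hfinal : surfDiv S X p = ‖grad S φ p‖ ^ 2 * rho p - normSqA S ν p * φ p ^ 2 * rho p
      - rho p * ‖grad S φ p - (φ p * (u p)⁻¹) • grad S u p‖ ^ 2 := by
    rw [hXp, hgf, hJ, hsq]
    simp only [f]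
    field_simp
    ring
  rw [hfinal]
  have := mul_nonneg (rho_pos p).le (sq_nonneg ‖grad S φ p - (φ p * (u p)⁻¹) • grad S u p‖)
  linarith

/-- Green's formula for the drift Laplacian `Δ - ⟨x, ∇ ·⟩ / 2`, from the divergence theorem for the
field `φ ρ ∇φ`. -/
theorem integral_stabOp_eq (hS : IsSmoothHypersurface S) (hν : IsUnitNormal S ν)
    (hφ : ContDiffOn ℝ 2 φ S) (hK : IsCompact K) (hKS : K ⊆ S)
    (h0 : ∀ p ∈ S, p ∉ K → φ p = 0) :
    (∫ x, -(φ x * stabOp S ν φ x) * rho x ∂(area S))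
        + (1 / 2) * ∫ x, φ x ^ 2 * rho x ∂(area S)
      = (∫ x, ‖grad S φ x‖ ^ 2 * rho x ∂(area S))
        - ∫ x, normSqA S ν x * φ x ^ 2 * rho x ∂(area S) := by
  have hφ1 : ContDiffOn ℝ 1 φ S := hφ.of_le (by norm_num)
  have hg : ContDiffOn ℝ 1 (grad S φ) S :=
    contDiffOn_grad hS hν (k := 1) (by norm_num) (by norm_num; exact hφ)
  let f : Amb n → ℝ := fun q => φ q * rho q
  let X : Amb n → Amb n := fun q => f q • grad S φ q
  have hX : ContDiffOn ℝ 1 X S := (hφ1.mul contDiff_rho.contDiffOn).smul hg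
  have hX0 : ∀ p ∈ S, p ∉ K → X p = 0 := fun p hp hpK => by simp [X, f, h0 p hp hpK]
  have hXt : ∀ p ∈ S, inner ℝ (ν p) (X p) = 0 := fun p hp => by
    simp [X, inner_smul_right, inner_normal_grad hS hν hp]
  have hdiv := integral_surfDiv_eq_zero hS hν hX hXt hK hKS hX0
  have hint0 : Integrable (surfDiv S X) (area S) :=
    integrable_area hS hν (continuousOn_surfDiv hS hν hX) hK hKS
      fun p hp hpK => surfDiv_eq_zero_of_notMem hK.isClosed hX0 hp hpK
  have hint1 := integrable_normSqA_mul hS hν hφ.continuousOn hK hKS h0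
  have hint2 := integrable_norm_grad_sq_mul hS hν hφ1 hK hKS h0
  have hint3 : Integrable (fun x => φ x ^ 2 * rho x) (area S) :=
    integrable_area hS hν ((hφ.continuousOn.pow 2).mul
      (contDiff_rho (k := 0)).continuous.continuousOn) hK hKS
      fun p hp hpK => by simp [h0 p hp hpK]
  have hpt : ∀ p ∈ S, -(φ p * stabOp S ν φ p) * rho p
      = ‖grad S φ p‖ ^ 2 * rho p - normSqA S ν p * φ p ^ 2 * rho p
        - (1 / 2) * (φ p ^ 2 * rho p) - surfDiv S X p := by
    intro p hp
    have hφd := ((hφ p hp).differentiableWithinAt (by simp)).hasFDerivWithinAt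
    have hfd : HasFDerivWithinAt f _ S p := hφd.mul (hasFDerivAt_rho p).hasFDerivWithinAt
    have hgt := inner_normal_grad hS hν hp φ
    have hgf : inner ℝ (grad S f p) (grad S φ p)
        = rho p * ‖grad S φ p‖ ^ 2 - (1 / 2) * φ p * rho p * inner ℝ p (grad S φ p) := by
      rw [← real_inner_self_eq_norm_sq (grad S φ p)]
      rw [inner_grad S f, inner_grad S φ, tangentDeriv_eq hfd, tangentDeriv_eq hφd]
      simp only [ContinuousLinearMap.comp_apply, tangentProj_of_tangent hS hν hp hgt]
      simp
      ring
    have hXp : surfDiv S X p = f p * laplacian S φ p + inner ℝ (grad S f p) (grad S φ p) :=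
      surfDiv_smul hS hν hp hfd.differentiableWithinAt
        ((hg p hp).differentiableWithinAt (by simp)) hgt
    rw [hXp, hgf, stabOp]
    simp only [f]
    ring
  have h1 : ∫ x, -(φ x * stabOp S ν φ x) * rho x ∂(area S) = _ :=
    setIntegral_congr_fun hS.measurableSet hpt
  rw [h1, integral_sub, integral_sub, integral_sub, integral_const_mul]
  · change _ - _ - _ - ∫ x, surfDiv S X x ∂(area S) + _ = _
    rw [hdiv]
    simp only [area]
    ring
  · exact hint2
  · exact hint1
  · exact hint2.sub hint1
  · exact hint3.const_mul _
  · exact (hint2.sub hint1).sub (hint3.const_mul _)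
  · exact hint0

end Inequality

end Shrinker

theorem mainTheorem12 (n : ℕ) (hn : 1 ≤ n) (S : Set (Shrinker.Amb n))
    (ν : Shrinker.Amb n → Shrinker.Amb n) (hS : Shrinker.IsSelfShrinker S ν) (R : ℝ)
    (hgraph : Shrinker.IsGraphicalIn S ν (Metric.closedBall 0 R)) :
    Shrinker.IsStableIn S ν (1 / 2) (Metric.closedBall 0 R) ∧
      ∀ φ : Shrinker.Amb n → ℝ, ContDiffOn ℝ 1 φ S →
        Shrinker.SupportedIn S (Metric.closedBall 0 R) φ →
          Integrable (fun x => Shrinker.normSqA S ν x * φ x ^ 2 * Shrinker.rho x)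
              (Shrinker.area S) ∧
            Integrable (fun x => ‖Shrinker.grad S φ x‖ ^ 2 * Shrinker.rho x)
              (Shrinker.area S) ∧
            ∫ x, Shrinker.normSqA S ν x * φ x ^ 2 * Shrinker.rho x ∂(Shrinker.area S) ≤
              ∫ x, ‖Shrinker.grad S φ x‖ ^ 2 * Shrinker.rho x ∂(Shrinker.area S) := by
  obtain ⟨v, hv⟩ := hgraph
  constructor
  · rintro φ hφ ⟨K, hK, hKS, h0⟩
    have hKS' : K ⊆ S := fun p hp => (hKS hp).1
    rw [Shrinker.integral_stabOp_eq hS.hypersurface hS.unitNormal hφ hK hKS' h0, sub_nonneg]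
    exact Shrinker.integral_normSqA_le hS (fun p hp => hv p (hKS hp)) (hφ.of_le (by norm_num)) hK
      hKS' h0
  · rintro φ hφ ⟨K, hK, hKS, h0⟩
    have hKS' : K ⊆ S := fun p hp => (hKS hp).1
    exact ⟨Shrinker.integrable_normSqA_mul hS.hypersurface hS.unitNormal hφ.continuousOn hK hKS' h0,
      Shrinker.integrable_norm_grad_sq_mul hS.hypersurface hS.unitNormal hφ hK hKS' h0,
      Shrinker.integral_normSqA_le hS (fun p hp => hv p (hKS hp)) hφ hK hKS' h0⟩
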